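/- Let $L$ be a finite-dimensional complex nilpotent Lie algebra acting on a complex Banach space $E$ by right continuous operators: each $x\in L$ acts by a bounded operator $e\mapsto ex$, linearly in $x$, and $e[x,y]=(ex)y-(ey)x$ for all $e\in E$ and $x,y\in L$ (for example, $L$ is a Lie subalgebra of the bounded operators of $E$, written on the right). For a linear form $f$ on $L$ with $f([L,L])=0$, let $(E\otimes\wedge L,d(f))$ be the complex with differentials $d_p(f)\colon E\otimes\wedge^pL\to E\otimes\wedge^{p-1}L$, $d_0(f)=0$, and $$d_p(f)\,e\langle x_1\wedge\dots\wedge x_p\rangle=\sum_{k=1}^p(-1)^{k+1}\bigl(ex_k-f(x_k)e\bigr)\langle x_1\wedge\dots\wedge\widehat{x_k}\wedge\dots\wedge x_p\rangle+\sum_{1\le k<l\le p}(-1)^{k+l}e\langle[x_k,x_l]\wedge x_1\wedge\dots\wedge\widehat{x_k}\wedge\dots\wedge\widehat{x_l}\wedge\dots\wedge x_p\rangle ,$$ and let $Sp(L,E)$ be the set of all linear forms $f$ on $L$ with $f([L,L])=0$ for which this complex has nonzero homology in some degree. Let $L'$ be the opposite Lie algebra of $L$, that is, the vector space $L$ with the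 bracket $[x,y]'=-[x,y]$; it acts by right continuous operators on the space $E^*$ of continuous linear functionals on $E$, where $x$ acts by the adjoint $x^*$, $(x^*\varphi)(e)=\varphi(ex)$. Then, as sets of linear forms on the vector space $L=L'$, $$Sp(L,E)=Sp(L',E^*).$$ -/

import Mathlib

open scoped TensorProduct

noncomputable section

/-- The Lie algebra `L'` opposite to `L`: the same vector space, with bracket
`⁅x, y⁆' = -⁅x, y⁆ = ⁅y, x⁆`. -/
def LieOpposite (L : Type*) : Type _ := L

namespace LieOpposite

variable (L : Type*) [LieRing L] [LieAlgebra ℂ L]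

instance : AddCommGroup (LieOpposite L) := inferInstanceAs (AddCommGroup L)

instance : Module ℂ (LieOpposite L) := inferInstanceAs (Module ℂ L)

/-- The identity map, as a linear isomorphism from `L` onto the vector space `L'`. -/
def of : L ≃ₗ[ℂ] LieOpposite L := LinearEquiv.refl ℂ L

instance : LieRing (LieOpposite L) where
  bracket x y := of L ⁅(of L).symm y, (of L).symm x⁆
  add_lie x y z := by rw [map_add, lie_add, map_add]
  lie_add x y z := by rw [map_add, add_lie, map_add]
  lie_self x := by simp
  leibniz_lie x y z := by
    simp only [LinearEquiv.symm_apply_apply, ← map_add]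
    congr 1
    rw [lie_lie, ← lie_skew ((of L).symm y) ⁅(of L).symm z, (of L).symm x⁆]
    abel

instance : LieAlgebra ℂ (LieOpposite L) where
  lie_smul c x y := by simp [Bracket.bracket]

variable {L}

theorem of_lie (x y : L) : of L ⁅x, y⁆ = ⁅of L y, of L x⁆ := rfl

end LieOpposite

section RightAction

variable {E : Type*} [NormedAddCommGroup E] [NormedSpace ℂ E]

/-- The adjoint `T* φ = φ ∘ T` of a bounded operator `T` of `E`, on the space `E*` of continuous
linear functionals. -/
def banachAdjoint : (E →L[ℂ] E) →ₗ[ℂ] (StrongDual ℂ E →L[ℂ] StrongDual ℂ E) :=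
  ((ContinuousLinearMap.compL ℂ E E ℂ).flip).toLinearMap

theorem banachAdjoint_apply (T : E →L[ℂ] E) (φ : StrongDual ℂ E) (e : E) :
    banachAdjoint T φ e = φ (T e) := rfl

variable {L : Type*} [LieRing L] [LieAlgebra ℂ L]

/-- An action of `L` on `E` by right continuous operators: every `x ∈ L` acts by a bounded operator
`e ↦ ex` of `E`, linearly in `x`, and `e⁅x, y⁆ = (ex)y - (ey)x`, i.e. `⁅x, y⁆` acts by the
commutator `xy - yx` of operators written on the right.  In particular, a Lie subalgebra of the
algebra of bounded operators of `E`, written on the right, acts on `E` in this way. -/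
structure RightAction (L E : Type*) [LieRing L] [LieAlgebra ℂ L] [NormedAddCommGroup E]
    [NormedSpace ℂ E] where
  /-- The operator `e ↦ ex` of `E` given by `x ∈ L`. -/
  operator : L →ₗ[ℂ] (E →L[ℂ] E)
  operator_lie : ∀ (x y : L) (e : E),
    operator ⁅x, y⁆ e = operator y (operator x e) - operator x (operator y e)

/-- The action of `L'` on `E*` by right continuous operators, `x` acting by the adjoint of the
operator by which it acts on `E`. -/
def RightAction.dual (ρ : RightAction L E) : RightAction (LieOpposite L) (StrongDual ℂ E) where
  operator := banachAdjoint ∘ₗ ρ.operator ∘ₗ (LieOpposite.of L).symm.toLinearMap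
  operator_lie := by
    intro x y φ
    obtain ⟨x, rfl⟩ := (LieOpposite.of L).surjective x
    obtain ⟨y, rfl⟩ := (LieOpposite.of L).surjective y
    ext e
    simp [← LieOpposite.of_lie, banachAdjoint_apply, ρ.operator_lie]

theorem RightAction.dual_operator_apply (ρ : RightAction L E) (x : L) (φ : StrongDual ℂ E)
    (e : E) : ρ.dual.operator (LieOpposite.of L x) φ e = φ (ρ.operator x e) := by
  simp [RightAction.dual, banachAdjoint_apply]

end RightAction

namespace LieComplex

variable {L E : Type*} [LieRing L] [LieAlgebra ℂ L] [NormedAddCommGroup E] [NormedSpace ℂ E]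

/-- `x ↦ (w ↦ (e ↦ e(x - f(x)) ⊗ w))`. -/
def shiftedTensor (ρ : RightAction L E) (f : Module.Dual ℂ L) (p : ℕ) :
    L →ₗ[ℂ] ⋀[ℂ]^p L →ₗ[ℂ] E →ₗ[ℂ] E ⊗[ℂ] ⋀[ℂ]^p L :=
  LinearMap.mk₂ ℂ
    (fun x w ↦ (TensorProduct.mk ℂ E (⋀[ℂ]^p L)).flip w ∘ₗ
      ((ρ.operator x : E →ₗ[ℂ] E) - f x • LinearMap.id))
    (fun x y w ↦ by ext e; simp [add_smul]; abel)
    (fun c x w ↦ by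
      ext e
      simp [smul_sub, mul_smul, TensorProduct.smul_tmul'])
    (fun x w w' ↦ by ext e; simp)
    (fun c x w ↦ by ext e; simp)

/-- The first sum of the differential,
`e⟨x₀ ∧ … ∧ x_p⟩ ↦ ∑ₖ (-1)ᵏ e(xₖ - f(xₖ))⟨x₀ ∧ … x̂ₖ … ∧ x_p⟩`. -/
def operatorPart (ρ : RightAction L E) (f : Module.Dual ℂ L) (p : ℕ) :
    E ⊗[ℂ] ⋀[ℂ]^(p + 1) L →ₗ[ℂ] E ⊗[ℂ] ⋀[ℂ]^p L :=
  TensorProduct.lift (LinearMap.flip (exteriorPower.alternatingMapLinearEquiv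
    (AlternatingMap.alternatizeUncurryFin
      { toFun := fun x ↦ (shiftedTensor ρ f p x).compAlternatingMap (exteriorPower.ιMulti ℂ p)
        map_add' := fun x y ↦ by ext; simp
        map_smul' := fun c x ↦ by ext; simp })))

/-- `x ↦ y ↦ (v ↦ ⁅x, y⁆ ∧ v₀ ∧ … ∧ v_{p-1})`. -/
def bracketWedge (L : Type*) [LieRing L] [LieAlgebra ℂ L] (p : ℕ) :
    L →ₗ[ℂ] L →ₗ[ℂ] L [⋀^Fin p]→ₗ[ℂ] ⋀[ℂ]^(p + 1) L :=
  LinearMap.mk₂ ℂ (fun x y ↦ (exteriorPower.ιMulti ℂ (p + 1)).curryLeft ⁅x, y⁆)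
    (by simp) (by simp) (by simp) (by simp)

/-- The second sum of the differential,
`⟨x₀ ∧ … ∧ x_p⟩ ↦ ∑_{k < l} (-1)ᵏ⁺ˡ ⟨⁅xₖ, x_l⁆ ∧ x₀ ∧ … x̂ₖ … x̂_l … ∧ x_p⟩`
(see `bracketPart_ιMulti`).  Summing over all ordered pairs of distinct indices, as
`alternatizeUncurryFin` does, counts each pair `k < l` twice, with the sign `-(-1)ᵏ⁺ˡ`. -/
def bracketPart (L : Type*) [LieRing L] [LieAlgebra ℂ L] :
    (p : ℕ) → ⋀[ℂ]^(p + 1) L →ₗ[ℂ] ⋀[ℂ]^p L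
  | 0 => 0
  | p + 1 => exteriorPower.alternatingMapLinearEquiv (-(2⁻¹ : ℂ) •
      AlternatingMap.alternatizeUncurryFin
        (AlternatingMap.alternatizeUncurryFinLM ∘ₗ bracketWedge L p))

/-- The differential `d_{p+1}(f) : E ⊗ ⋀^{p+1} L → E ⊗ ⋀^p L`. -/
def d (ρ : RightAction L E) (f : Module.Dual ℂ L) (p : ℕ) :
    E ⊗[ℂ] ⋀[ℂ]^(p + 1) L →ₗ[ℂ] E ⊗[ℂ] ⋀[ℂ]^p L :=
  operatorPart ρ f p + LinearMap.lTensor E (bracketPart L p)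

theorem operatorPart_tmul_ιMulti (ρ : RightAction L E) (f : Module.Dual ℂ L) (p : ℕ)
    (e : E) (x : Fin (p + 1) → L) :
    operatorPart ρ f p (e ⊗ₜ exteriorPower.ιMulti ℂ (p + 1) x) =
      ∑ k : Fin (p + 1), (-1 : ℤ) ^ (k : ℕ) •
        ((ρ.operator (x k) e - f (x k) • e) ⊗ₜ[ℂ]
          exteriorPower.ιMulti ℂ p (k.removeNth x)) := by
  simp only [operatorPart, TensorProduct.lift.tmul, LinearMap.flip_apply,
    exteriorPower.alternatingMapLinearEquiv_apply_ιMulti,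
    AlternatingMap.alternatizeUncurryFin_apply, LinearMap.sum_apply, LinearMap.smul_apply]
  rfl

/-- The pairs `k < l` are written here as `k = i.castSucc`, `l = j.succ` with `i ≤ j`. -/
theorem bracketPart_ιMulti (p : ℕ) (x : Fin (p + 2) → L) :
    bracketPart L (p + 1) (exteriorPower.ιMulti ℂ (p + 2) x) =
      ∑ i : Fin (p + 1), ∑ j ≥ i, (-1 : ℤ) ^ ((i : ℕ) + ((j : ℕ) + 1)) •
        exteriorPower.ιMulti ℂ (p + 1) (Fin.cons ⁅x i.castSucc, x j.succ⁆
          (j.removeNth (i.castSucc.removeNth x))) := by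
  have h (y z : L) (v : Fin p → L) : bracketWedge L p y z v - bracketWedge L p z y v =
      (2 : ℂ) • exteriorPower.ιMulti ℂ (p + 1) (Fin.cons ⁅y, z⁆ v) := by
    have : bracketWedge L p z y = - bracketWedge L p y z := by
      simp only [bracketWedge, LinearMap.mk₂_apply]
      rw [← lie_skew z y, map_neg]
    rw [this, AlternatingMap.neg_apply, sub_neg_eq_add, ← two_smul ℂ]
    rfl
  simp only [bracketPart, exteriorPower.alternatingMapLinearEquiv_apply_ιMulti,
    AlternatingMap.smul_apply,
    AlternatingMap.alternatizeUncurryFin_alternatizeUncurryFinLM_comp_apply, Finset.smul_sum, h]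
  refine Finset.sum_congr rfl fun i _ ↦ Finset.sum_congr rfl fun j _ ↦ ?_
  rw [smul_comm, smul_smul, ← add_assoc, pow_succ]
  simp

/-- The differential is the classical one, written here with indices that start at `0`. -/
theorem d_tmul_ιMulti (ρ : RightAction L E) (f : Module.Dual ℂ L) (p : ℕ)
    (e : E) (x : Fin (p + 2) → L) :
    d ρ f (p + 1) (e ⊗ₜ exteriorPower.ιMulti ℂ (p + 2) x) =
      ∑ k : Fin (p + 2), (-1 : ℤ) ^ (k : ℕ) •
        ((ρ.operator (x k) e - f (x k) • e) ⊗ₜ[ℂ]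
          exteriorPower.ιMulti ℂ (p + 1) (k.removeNth x)) +
      ∑ i : Fin (p + 1), ∑ j ≥ i, (-1 : ℤ) ^ ((i : ℕ) + ((j : ℕ) + 1)) •
        (e ⊗ₜ[ℂ] exteriorPower.ιMulti ℂ (p + 1) (Fin.cons ⁅x i.castSucc, x j.succ⁆
          (j.removeNth (i.castSucc.removeNth x)))) := by
  rw [d, LinearMap.add_apply, operatorPart_tmul_ιMulti, LinearMap.lTensor_tmul,
    bracketPart_ιMulti]
  simp only [TensorProduct.tmul_sum, TensorProduct.tmul_smul]

/-- The `p`-cycles `ker d_p(f)`, where `d_0(f) = 0`. -/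
def cycles (ρ : RightAction L E) (f : Module.Dual ℂ L) :
    (p : ℕ) → Submodule ℂ (E ⊗[ℂ] ⋀[ℂ]^p L)
  | 0 => ⊤
  | p + 1 => LinearMap.ker (d ρ f p)

/-- The `p`-th homology space `ker d_p(f) / im d_{p+1}(f)` of the complex `(E ⊗ ⋀ L, d(f))`. -/
abbrev Homology (ρ : RightAction L E) (f : Module.Dual ℂ L) (p : ℕ) : Type _ :=
  cycles ρ f p ⧸ (LinearMap.range (d ρ f p)).submoduleOf (cycles ρ f p)

end LieComplex

/-- The joint spectrum `Sp(L, E)`: the linear forms `f` on `L` that vanish on `⁅L, L⁆` and for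
which the complex `(E ⊗ ⋀ L, d(f))` has nonzero homology. -/
def jointSpectrum {L E : Type*} [LieRing L] [LieAlgebra ℂ L] [NormedAddCommGroup E]
    [NormedSpace ℂ E] (ρ : RightAction L E) : Set (Module.Dual ℂ L) :=
  {f | (∀ x y : L, f ⁅x, y⁆ = 0) ∧ ∃ p : ℕ, Nontrivial (LieComplex.Homology ρ f p)}

end

/-! Write n = dim L. Up to sign, the complex of (L', E*) is the complex of continuous functionals on
(E ⊗ ⋀L, d(f)), read in complementary degree; and a complex of Banach spaces is exact if and only if
its dual is.

The first half is Poincaré duality. A functional ω on the exterior algebra that is nonzero on the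
top power gives, for p + q = n, an isomorphism E* ⊗ ⋀^q L' ≅ Hom(⋀^p L, E*), φ ⊗ w ↦ (v ↦ ω(v ∧ w)φ)
(`poincare_bijective`). It carries d to the transpose of d up to (-1)^p (`functionalOf_poincare_d`).
This rests on Cartan's formula d(y ∧ c) = θ_y c - y ∧ dc (`d_succ_tensorWedge`), with θ_y the action
of y, and on the invariance of the pairing under θ. Invariance needs derivations induced by ad y to
kill the top power, that is, tr ad y = 0; nilpotency gives this.

The second half is functional analysis. From exactness to dual exactness: ranges are kernels, hence
closed, and functionals descend and extend (`dual_exact_of_exact`). Conversely, dual exactness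
bounds preimages under the adjoint, which closes the ranges (`isClosed_range_of_dual_exact`), while
Hahn–Banach makes them dense in the kernels (`mem_closure_range_of_dual_exact`). -/

namespace exteriorPower

/-! ### Exterior powers: left multiplication and derivations. -/

variable {R M N : Type*} [CommRing R] [AddCommGroup M] [Module R M] [AddCommGroup N] [Module R N]

variable (R M) in
/-- Left multiplication `w ↦ y ∧ w`, as a map between exterior powers. -/
noncomputable def wedge (p : ℕ) : M →ₗ[R] ⋀[R]^p M →ₗ[R] ⋀[R]^(p + 1) M :=
  (alternatingMapLinearEquiv (R := R) (M := M) (n := p)).toLinearMap ∘ₗ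
    (ιMulti R (p + 1)).curryLeft

theorem wedge_ιMulti {p : ℕ} (y : M) (v : Fin p → M) :
    wedge R M p y (ιMulti R p v) = ιMulti R (p + 1) (Fin.cons y v) := by
  simp [wedge, Matrix.vecCons]

theorem coe_wedge {p : ℕ} (y : M) (w : ⋀[R]^p M) :
    (wedge R M p y w : ExteriorAlgebra R M) = ExteriorAlgebra.ι R y * w := by
  have : (⋀[R]^(p + 1) M).subtype ∘ₗ wedge R M p y =
      LinearMap.mulLeft R (ExteriorAlgebra.ι R y) ∘ₗ (⋀[R]^p M).subtype := by
    ext v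
    simp [wedge_ιMulti, ExteriorAlgebra.ιMulti_succ_apply, Matrix.vecTail, Function.comp_def]
  exact LinearMap.congr_fun this w

/-- The products y ∧ w span the next exterior power. This turns the later identities into inductions
on the degree, free of indexed sums. -/
theorem wedge_ext {p : ℕ} {f g : ⋀[R]^(p + 1) M →ₗ[R] N}
    (h : ∀ y w, f (wedge R M p y w) = g (wedge R M p y w)) : f = g := by
  ext v
  have := h (v 0) (ιMulti R p (Fin.tail v))
  rwa [wedge_ιMulti, Fin.cons_self_tail] at this

theorem wedge_wedge_self {p : ℕ} (y : M) (w : ⋀[R]^p M) :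
    wedge R M (p + 1) y (wedge R M p y w) = 0 := by
  apply Subtype.ext
  simp [coe_wedge, ← mul_assoc]

theorem wedge_wedge_swap {p : ℕ} (y z : M) (w : ⋀[R]^p M) :
    wedge R M (p + 1) y (wedge R M p z w) = -wedge R M (p + 1) z (wedge R M p y w) := by
  have := wedge_wedge_self (y + z) w
  simp only [map_add, LinearMap.add_apply, wedge_wedge_self, zero_add, add_zero] at this
  exact eq_neg_of_add_eq_zero_right this

/-- The derivation of the exterior powers of `M` that extends an endomorphism of `M`. -/
noncomputable def derivationOf (T : M →ₗ[R] M) : (p : ℕ) → ⋀[R]^p M →ₗ[R] ⋀[R]^p M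
  | 0 => 0
  | p + 1 => alternatingMapLinearEquiv
      (AlternatingMap.alternatizeUncurryFin ((ιMulti R (p + 1)).curryLeft ∘ₗ T))

theorem derivationOf_zero (T : M →ₗ[R] M) : derivationOf T 0 = 0 := rfl

theorem derivationOf_ιMulti (T : M →ₗ[R] M) {p : ℕ} (v : Fin (p + 1) → M) :
    derivationOf T (p + 1) (ιMulti R (p + 1) v) =
      ∑ k : Fin (p + 1), (-1 : ℤ) ^ (k : ℕ) •
        ιMulti R (p + 1) (Fin.cons (T (v k)) (k.removeNth v)) := by
  simp [derivationOf, AlternatingMap.alternatizeUncurryFin_apply, Matrix.vecCons]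

theorem removeNth_succ_cons {M : Type*} {p : ℕ} (k : Fin (p + 1)) (y : M) (v : Fin (p + 1) → M) :
    k.succ.removeNth (Fin.cons y v : Fin (p + 2) → M) =
      (Fin.cons y (k.removeNth v) : Fin (p + 1) → M) := by
  ext i
  cases i using Fin.cases <;> simp [Fin.removeNth]

/-- Leibniz rule. Together with the value 0 in degree 0 it determines the derivation, and it
replaces the explicit sum from here on. -/
theorem derivationOf_wedge (T : M →ₗ[R] M) {p : ℕ} (z : M) (w : ⋀[R]^p M) :
    derivationOf T (p + 1) (wedge R M p z w) =
      wedge R M p z (derivationOf T p w) + wedge R M p (T z) w := by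
  suffices derivationOf T (p + 1) ∘ₗ wedge R M p z =
      wedge R M p z ∘ₗ derivationOf T p + wedge R M p (T z) from
    LinearMap.congr_fun this w
  ext1
  ext1 v
  simp only [LinearMap.compAlternatingMap_apply, LinearMap.comp_apply, LinearMap.add_apply,
    wedge_ιMulti, derivationOf_ιMulti]
  cases p with
  | zero => simp [derivationOf]
  | succ p =>
    rw [derivationOf_ιMulti, map_sum, Fin.sum_univ_succ]
    refine (add_comm _ _).trans ?_
    congr 1
    · refine Finset.sum_congr rfl fun k _ ↦ ?_
      rw [removeNth_succ_cons, map_zsmul, Fin.cons_succ, ← wedge_ιMulti, ← wedge_ιMulti,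
        wedge_wedge_swap, ← wedge_ιMulti]
      simp [pow_succ]
    · simp

theorem derivationOf_neg (T : M →ₗ[R] M) {p : ℕ} : derivationOf (-T) p = -derivationOf T p := by
  induction p with
  | zero => exact (neg_zero (G := ⋀[R]^0 M →ₗ[R] ⋀[R]^0 M)).symm
  | succ p ih => exact wedge_ext fun y w ↦ by simp [derivationOf_wedge, ih]; abel

/-- A commutator of derivations again satisfies the Leibniz rule, so the relation on M propagates to
all degrees. -/
theorem derivationOf_commutator (S T U : M →ₗ[R] M) (h : ∀ z, S (T z) - T (S z) = U z) {p : ℕ}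
    (w : ⋀[R]^p M) : derivationOf S p (derivationOf T p w) - derivationOf T p (derivationOf S p w) =
      derivationOf U p w := by
  suffices derivationOf S p ∘ₗ derivationOf T p - derivationOf T p ∘ₗ derivationOf S p =
      derivationOf U p from
    LinearMap.congr_fun this w
  induction p with
  | zero => exact sub_zero (0 : ⋀[R]^0 M →ₗ[R] ⋀[R]^0 M)
  | succ p ih =>
    refine wedge_ext fun y w ↦ ?_
    simp only [LinearMap.sub_apply, LinearMap.comp_apply, derivationOf_wedge, map_add, ← h, ← ih w,
      map_sub]
    abel

/-- On the top exterior power, a derivation is the multiplication by the trace; this is the case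
of trace zero. -/
theorem derivationOf_eq_zero_of_trace_eq_zero {n : ℕ} (b : Module.Basis (Fin n) R M) (T : M →ₗ[R] M)
    (hT : LinearMap.trace R M T = 0) : derivationOf T n = 0 := by
  cases n with
  | zero => rfl
  | succ n =>
  refine linearMap_ext ?_
  refine b.ext_alternating fun v hv ↦ ?_
  -- Expand T(b k) in the basis: every term off the diagonal repeats a basis vector and vanishes.
  -- Summing over k then produces the trace.
  have key (k : Fin (n + 1)) : (-1 : ℤ) ^ (k : ℕ) •
      ιMulti R (n + 1) (Fin.cons (T (b k)) (k.removeNth b)) =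
      b.repr (T (b k)) k • ιMulti R (n + 1) b := by
    have := AlternatingMap.neg_one_pow_smul_map_insertNth (ιMulti R (n + 1) (M := M)) k
      (T (b k)) (k.removeNth b)
    rw [Matrix.vecCons] at this
    rw [← this, smul_smul, ← mul_pow, neg_one_mul, neg_neg, one_pow, one_smul,
      Fin.insertNth_removeNth]
    conv_lhs => rw [← b.sum_repr (T (b k))]
    rw [AlternatingMap.map_update_sum]
    rw [Finset.sum_eq_single k]
    · rw [AlternatingMap.map_update_smul]; simp
    · intro i _ hi
      rw [AlternatingMap.map_update_smul, AlternatingMap.map_update_self _ _ hi.symm, smul_zero]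
    · simp
  have hb : derivationOf T (n + 1) (ιMulti R (n + 1) b) = 0 := by
    rw [derivationOf_ιMulti, Finset.sum_congr rfl fun k _ ↦ key k, ← Finset.sum_smul]
    rw [LinearMap.trace_eq_matrix_trace R b, Matrix.trace] at hT
    simp only [Matrix.diag, LinearMap.toMatrix_apply] at hT
    rw [hT, zero_smul]
  let σ := Equiv.ofBijective v (Finite.injective_iff_bijective.mp hv)
  have : (fun i ↦ b (v i)) = b ∘ σ := rfl
  rw [this]
  simp only [LinearMap.compAlternatingMap_apply, LinearMap.zero_apply]
  rw [AlternatingMap.map_perm, LinearMap.map_smul_of_tower, hb, smul_zero]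

end exteriorPower

/-! ### Cartan's formula and d ∘ d = 0. -/

namespace LieComplex

open exteriorPower

variable {L E : Type*} [LieRing L] [LieAlgebra ℂ L] [NormedAddCommGroup E] [NormedSpace ℂ E]
  {N : Type*} [AddCommGroup N] [Module ℂ N]

variable (L E) in
/-- Left multiplication `e ⊗ w ↦ e ⊗ (y ∧ w)`. -/
noncomputable def tensorWedge (p : ℕ) (y : L) : E ⊗[ℂ] ⋀[ℂ]^p L →ₗ[ℂ] E ⊗[ℂ] ⋀[ℂ]^(p + 1) L :=
  LinearMap.lTensor E (wedge ℂ L p y)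

theorem tensorWedge_tmul {p : ℕ} (y : L) (e : E) (w : ⋀[ℂ]^p L) :
    tensorWedge L E p y (e ⊗ₜ w) = e ⊗ₜ wedge ℂ L p y w := rfl

theorem tensorWedge_ext {p : ℕ} {f g : E ⊗[ℂ] ⋀[ℂ]^(p + 1) L →ₗ[ℂ] N}
    (h : ∀ y c, f (tensorWedge L E p y c) = g (tensorWedge L E p y c)) : f = g := by
  refine TensorProduct.ext (LinearMap.ext fun e ↦ wedge_ext fun y w ↦ ?_)
  simpa [tensorWedge_tmul] using h y (e ⊗ₜ w)

/-- The action of `y` on `E ⊗ ⋀ L`, where the action on `E` is shifted by `f`, and `y` acts on `L`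
by `z ↦ ⁅z, y⁆`. -/
noncomputable def tensorAction (ρ : RightAction L E) (f : Module.Dual ℂ L) (p : ℕ) (y : L) :
    E ⊗[ℂ] ⋀[ℂ]^p L →ₗ[ℂ] E ⊗[ℂ] ⋀[ℂ]^p L :=
  LinearMap.rTensor _ ((ρ.operator y : E →ₗ[ℂ] E) - f y • LinearMap.id) +
    LinearMap.lTensor E (derivationOf (-(LieAlgebra.ad ℂ L y)) p)

theorem tensorAction_tmul (ρ : RightAction L E) (f : Module.Dual ℂ L) {p : ℕ} (y : L)
    (e : E) (w : ⋀[ℂ]^p L) : tensorAction ρ f p y (e ⊗ₜ w) =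
      (ρ.operator y e - f y • e) ⊗ₜ w + e ⊗ₜ derivationOf (-(LieAlgebra.ad ℂ L y)) p w := by
  simp [tensorAction, TensorProduct.sub_tmul, TensorProduct.smul_tmul']

theorem tensorAction_tensorWedge (ρ : RightAction L E) (f : Module.Dual ℂ L) {p : ℕ} (y z : L)
    (c : E ⊗[ℂ] ⋀[ℂ]^p L) : tensorAction ρ f (p + 1) y (tensorWedge L E p z c) =
      tensorWedge L E p z (tensorAction ρ f p y c) - tensorWedge L E p ⁅y, z⁆ c := by
  induction c with
  | zero => simp
  | tmul e w =>
    rw [tensorWedge_tmul, tensorAction_tmul, tensorAction_tmul, derivationOf_wedge, map_add,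
      tensorWedge_tmul, tensorWedge_tmul, tensorWedge_tmul, TensorProduct.tmul_add,
      LinearMap.neg_apply, LieAlgebra.ad_apply, map_neg, LinearMap.neg_apply,
      TensorProduct.tmul_neg]
    abel
  | add a b ha hb => simp only [map_add, ha, hb]; abel

/-- Operators on the right reverse commutators, hence the minus sign. The shift by f does not
disturb the relation: scalars commute and f kills brackets. -/
theorem tensorAction_commutator (ρ : RightAction L E) (f : Module.Dual ℂ L)
    (hf : ∀ x y : L, f ⁅x, y⁆ = 0) {p : ℕ} (y z : L) (c : E ⊗[ℂ] ⋀[ℂ]^p L) :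
    tensorAction ρ f p y (tensorAction ρ f p z c) - tensorAction ρ f p z (tensorAction ρ f p y c) =
      -tensorAction ρ f p ⁅y, z⁆ c := by
  induction c with
  | zero => simp
  | tmul e w =>
    have h := derivationOf_commutator (-(LieAlgebra.ad ℂ L y)) (-(LieAlgebra.ad ℂ L z))
      (LieAlgebra.ad ℂ L ⁅y, z⁆) (by simp [-lie_skew]) w
    have h' : derivationOf (-(LieAlgebra.ad ℂ L ⁅y, z⁆)) p w =
        -derivationOf (LieAlgebra.ad ℂ L ⁅y, z⁆) p w := by
      rw [derivationOf_neg, LinearMap.neg_apply]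
    have hE : ρ.operator y (ρ.operator z e - f z • e) - f y • (ρ.operator z e - f z • e) -
        (ρ.operator z (ρ.operator y e - f y • e) - f z • (ρ.operator y e - f y • e)) =
        -(ρ.operator ⁅y, z⁆ e - f ⁅y, z⁆ • e) := by
      rw [hf, ρ.operator_lie, map_sub, map_sub, map_smul, map_smul, smul_sub, smul_sub,
        smul_comm (f y) (f z)]
      simp only [zero_smul]
      abel
    simp only [tensorAction_tmul, map_add, h', ← h, TensorProduct.tmul_neg, neg_add, neg_neg,
      TensorProduct.tmul_sub, ← TensorProduct.neg_tmul, ← hE]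
    simp only [TensorProduct.sub_tmul]
    abel
  | add a b ha hb => rw [map_add, map_add, map_add, map_add, map_add, neg_add, ← ha, ← hb]; abel

theorem operatorPart_zero_tensorWedge (ρ : RightAction L E) (f : Module.Dual ℂ L) (y : L)
    (e : E) (w : ⋀[ℂ]^0 L) : operatorPart ρ f 0 (e ⊗ₜ wedge ℂ L 0 y w) =
      (ρ.operator y e - f y • e) ⊗ₜ w := by
  suffices operatorPart ρ f 0 ∘ₗ TensorProduct.mk ℂ _ _ e ∘ₗ wedge ℂ L 0 y =
      TensorProduct.mk ℂ _ _ (ρ.operator y e - f y • e) from LinearMap.congr_fun this w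
  ext1
  ext1 v
  simp [wedge_ιMulti, operatorPart_tmul_ιMulti, TensorProduct.sub_tmul, TensorProduct.smul_tmul']

theorem operatorPart_tensorWedge (ρ : RightAction L E) (f : Module.Dual ℂ L) {p : ℕ} (y : L)
    (e : E) (w : ⋀[ℂ]^(p + 1) L) : operatorPart ρ f (p + 1) (e ⊗ₜ wedge ℂ L (p + 1) y w) =
      (ρ.operator y e - f y • e) ⊗ₜ w - tensorWedge L E p y (operatorPart ρ f p (e ⊗ₜ w)) := by
  suffices operatorPart ρ f (p + 1) ∘ₗ TensorProduct.mk ℂ _ _ e ∘ₗ wedge ℂ L (p + 1) y =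
      TensorProduct.mk ℂ _ _ (ρ.operator y e - f y • e) -
        tensorWedge L E p y ∘ₗ operatorPart ρ f p ∘ₗ TensorProduct.mk ℂ _ _ e from
    LinearMap.congr_fun this w
  ext1
  ext1 v
  simp only [LinearMap.compAlternatingMap_apply, LinearMap.comp_apply, LinearMap.sub_apply,
    TensorProduct.mk_apply, wedge_ιMulti, operatorPart_tmul_ιMulti, map_sum]
  rw [Fin.sum_univ_succ, sub_eq_add_neg (_ ⊗ₜ[ℂ] _), ← Finset.sum_neg_distrib]
  congr 1
  · simp
  · refine Finset.sum_congr rfl fun k _ ↦ ?_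
    rw [removeNth_succ_cons, map_zsmul, Fin.cons_succ, tensorWedge_tmul, wedge_ιMulti]
    simp [pow_succ]

/-- Among the pairs k < l, those with k = 0 bracket y with another factor and add up to the
derivation; the others leave y in place. -/
theorem bracketPart_wedge {p : ℕ} (y : L) (w : ⋀[ℂ]^(p + 1) L) :
    bracketPart L (p + 1) (wedge ℂ L (p + 1) y w) =
      derivationOf (-(LieAlgebra.ad ℂ L y)) (p + 1) w - wedge ℂ L p y (bracketPart L p w) := by
  suffices bracketPart L (p + 1) ∘ₗ wedge ℂ L (p + 1) y =
      derivationOf (-(LieAlgebra.ad ℂ L y)) (p + 1) - wedge ℂ L p y ∘ₗ bracketPart L p from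
    LinearMap.congr_fun this w
  ext1
  ext1 v
  simp only [LinearMap.compAlternatingMap_apply, LinearMap.comp_apply, LinearMap.sub_apply,
    wedge_ιMulti, derivationOf_ιMulti, bracketPart_ιMulti]
  rw [Fin.sum_univ_succ, sub_eq_add_neg]
  congr 1
  · refine Finset.sum_congr (by ext; simp) fun k _ ↦ ?_
    have : (Fin.cons (-⁅y, v k⁆) (k.removeNth v) : Fin (p + 1) → L) =
      Function.update (Fin.cons ⁅y, v k⁆ (k.removeNth v)) 0 (-⁅y, v k⁆) := by simp
    simp only [LinearMap.neg_apply, LieAlgebra.ad_apply, this, AlternatingMap.map_update_neg]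
    simp [pow_succ]
  · cases p with
    | zero => simp [bracketPart]
    | succ p =>
      rw [bracketPart_ιMulti, map_sum, ← Finset.sum_neg_distrib]
      refine Finset.sum_congr rfl fun i _ ↦ ?_
      rw [map_sum, ← Finset.sum_neg_distrib]
      refine (Finset.sum_congr (s₂ := (Finset.Ici i).map (Fin.succEmb _)) ?_ fun _ _ ↦ rfl).trans ?_
      · ext j
        cases j using Fin.cases <;> simp
      rw [Finset.sum_map]
      refine Finset.sum_congr (by ext; simp) fun j _ ↦ ?_
      -- In these terms y stands second, behind the bracket; moving it to the front gives the minus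
      -- sign.
      have h (u : Fin p → L) (x : L) :
          ιMulti ℂ (p + 2) (Fin.cons x (Fin.cons y u : Fin (p + 1) → L)) =
          -wedge ℂ L (p + 1) y (ιMulti ℂ (p + 1) (Fin.cons x u)) := by
        rw [← wedge_ιMulti, ← wedge_ιMulti, wedge_wedge_swap, wedge_ιMulti x]
      rw [Fin.castSucc_succ, removeNth_succ_cons, Fin.coe_succEmb, removeNth_succ_cons, h, map_zsmul]
      simp [pow_add]

variable (ρ : RightAction L E) (f : Module.Dual ℂ L)

theorem d_zero_tensorWedge (y : L) (c : E ⊗[ℂ] ⋀[ℂ]^0 L) :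
    d ρ f 0 (tensorWedge L E 0 y c) = tensorAction ρ f 0 y c := by
  induction c with
  | zero => simp
  | tmul e w =>
    rw [tensorWedge_tmul, tensorAction_tmul, d, LinearMap.add_apply, operatorPart_zero_tensorWedge]
    simp [bracketPart, derivationOf]
  | add a b ha hb => simp only [map_add, ha, hb]

/-- Cartan's homotopy formula. With its degree-zero case it determines d recursively, and all later
facts about d on wedge products follow from it. -/
theorem d_succ_tensorWedge {p : ℕ} (y : L) (c : E ⊗[ℂ] ⋀[ℂ]^(p + 1) L) :
    d ρ f (p + 1) (tensorWedge L E (p + 1) y c) =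
      tensorAction ρ f (p + 1) y c - tensorWedge L E p y (d ρ f p c) := by
  induction c with
  | zero => simp
  | tmul e w =>
    rw [tensorWedge_tmul, tensorAction_tmul, d, d, LinearMap.add_apply, LinearMap.add_apply,
      operatorPart_tensorWedge, LinearMap.lTensor_tmul, bracketPart_wedge, map_add,
      LinearMap.lTensor_tmul, tensorWedge_tmul, TensorProduct.tmul_sub]
    abel
  | add a b ha hb => simp only [map_add, ha, hb]; abel

variable {f}

/-- On z ∧ c, Cartan's formula turns both sides into the commutation relation of θ_y and θ_z, plus
terms settled by induction. -/
theorem tensorAction_d (hf : ∀ x y : L, f ⁅x, y⁆ = 0) {p : ℕ} (y : L)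
    (c : E ⊗[ℂ] ⋀[ℂ]^(p + 1) L) :
    tensorAction ρ f p y (d ρ f p c) = d ρ f p (tensorAction ρ f (p + 1) y c) := by
  suffices tensorAction ρ f p y ∘ₗ d ρ f p = d ρ f p ∘ₗ tensorAction ρ f (p + 1) y from
    LinearMap.congr_fun this c
  induction p with
  | zero =>
    refine tensorWedge_ext fun z c ↦ ?_
    have := tensorAction_commutator ρ f hf y z c
    simp only [LinearMap.comp_apply, tensorAction_tensorWedge, d_zero_tensorWedge, map_sub]
    rw [sub_eq_iff_eq_add] at this
    rw [this]
    abel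
  | succ p ih =>
    refine tensorWedge_ext fun z c ↦ ?_
    have := tensorAction_commutator ρ f hf y z c
    have ih' := LinearMap.congr_fun (ih c) c
    simp only [LinearMap.comp_apply] at ih'
    simp only [LinearMap.comp_apply, tensorAction_tensorWedge, d_succ_tensorWedge, map_sub, ih']
    rw [sub_eq_iff_eq_add] at this
    rw [this]
    abel

/-- Applying Cartan's formula twice gives dd(z ∧ c) = dθ_z c - θ_z dc + z ∧ ddc; the first two terms
cancel and the last vanishes by induction. -/
theorem d_comp_d (hf : ∀ x y : L, f ⁅x, y⁆ = 0) (p : ℕ) : d ρ f p ∘ₗ d ρ f (p + 1) = 0 := by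
  induction p with
  | zero =>
    refine tensorWedge_ext fun z c ↦ ?_
    simp [d_succ_tensorWedge, d_zero_tensorWedge, tensorAction_d ρ hf]
  | succ p ih =>
    refine tensorWedge_ext fun z c ↦ ?_
    have := LinearMap.congr_fun ih c
    simp only [LinearMap.comp_apply, LinearMap.zero_apply] at this
    simp [d_succ_tensorWedge, tensorAction_d ρ hf, this]

end LieComplex

/-! ### Exactness of Banach complexes and of their duals. -/

section Banach

open Filter Topology

variable {W X Y : Type*} [NormedAddCommGroup W] [NormedSpace ℂ W] [NormedAddCommGroup X]
  [NormedSpace ℂ X] [NormedAddCommGroup Y] [NormedSpace ℂ Y]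

namespace ContinuousLinearMap

/-- If every vector of the closure of the range of `T` has approximate preimages of controlled
norm, then the range of `T` is closed. -/
theorem isClosed_range_of_approx_preimage [CompleteSpace X] (T : X →L[ℂ] Y) (C : ℝ)
    (h : ∀ y ∈ closure (Set.range T), ∃ x, ‖y - T x‖ ≤ 1 / 2 * ‖y‖ ∧ ‖x‖ ≤ C * ‖y‖) :
    IsClosed (Set.range T) := by
  rw [← closure_subset_iff_isClosed]
  intro y hy
  have hmem (y : Y) (hy : y ∈ closure (Set.range T)) (x : X) :
      y - T x ∈ closure (Set.range T) := by
    have hcl : closure (Set.range T) = (T.range.topologicalClosure : Set Y) := by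
      rfl
    rw [hcl] at hy ⊢
    exact sub_mem hy (T.range.le_topologicalClosure ⟨x, rfl⟩)
  choose! g hg using h
  -- Successive approximation: r is the error left by one approximate preimage. Iterated errors
  -- halve, so the corrections form an absolutely convergent series that sums to a preimage.
  let r (y : Y) : Y := y - T (g y)
  have hr (n : ℕ) : r^[n] y ∈ closure (Set.range T) ∧ ‖r^[n] y‖ ≤ (1 / 2) ^ n * ‖y‖ := by
    induction n with
    | zero => simpa using hy
    | succ n ih =>
      rw [Function.iterate_succ_apply']
      refine ⟨hmem _ ih.1 _, (hg _ ih.1).1.trans ?_⟩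
      rw [pow_succ', mul_assoc]
      exact mul_le_mul_of_nonneg_left ih.2 (by norm_num)
  have hu (n : ℕ) : ‖g (r^[n] y)‖ ≤ (1 / 2) ^ n * (|C| * ‖y‖) := calc
    ‖g (r^[n] y)‖ ≤ C * ‖r^[n] y‖ := (hg _ (hr n).1).2
    _ ≤ |C| * ((1 / 2) ^ n * ‖y‖) :=
      mul_le_mul (le_abs_self C) (hr n).2 (norm_nonneg _) (abs_nonneg C)
    _ = (1 / 2) ^ n * (|C| * ‖y‖) := by ring
  have su : Summable fun n ↦ g (r^[n] y) :=
    .of_norm_bounded (summable_geometric_two.mul_right _) hu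
  have hsum (n : ℕ) : T (∑ i ∈ Finset.range n, g (r^[i] y)) = y - r^[n] y := by
    induction n with
    | zero => simp
    | succ n ih => rw [Finset.sum_range_succ, map_add, ih, Function.iterate_succ_apply', sub_add]
  have h₁ := (T.continuous.tendsto _).comp su.hasSum.tendsto_sum_nat
  have h₂ : Tendsto (fun n ↦ y - r^[n] y) atTop (𝓝 (y - 0)) := by
    refine tendsto_const_nhds.sub (squeeze_zero_norm (fun n ↦ (hr n).2) ?_)
    simpa using (tendsto_pow_atTop_nhds_zero_of_lt_one (r := (1 / 2 : ℝ)) (by norm_num)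
      (by norm_num)).mul_const ‖y‖
  refine ⟨_, tendsto_nhds_unique h₁ (h₂.congr fun n ↦ (hsum n).symm) |>.trans (sub_zero y)⟩

/-- Approximate preimages, from a bound on the functionals modulo those that vanish on the
range of `T`. -/
theorem exists_approx_preimage_of_dual_bound (T : X →L[ℂ] Y) {C : ℝ} (hC : 0 < C)
    (h : ∀ ψ : StrongDual ℂ Y, ∃ ψ' : StrongDual ℂ Y, ψ'.comp T = ψ.comp T ∧
      ‖ψ'‖ ≤ C * ‖ψ.comp T‖) (y : Y) (hy : y ∈ closure (Set.range T)) :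
    ∃ x, ‖y - T x‖ ≤ 1 / 2 * ‖y‖ ∧ ‖x‖ ≤ C * ‖y‖ := by
  rcases eq_or_ne y 0 with rfl | hy0
  · exact ⟨0, by simp⟩
  have hy0' : 0 < ‖y‖ := norm_pos_iff.mpr hy0
  suffices hmem : y ∈ closure (T '' Metric.closedBall 0 (C * ‖y‖)) by
    obtain ⟨_, ⟨x, hx, rfl⟩, hxy⟩ := Metric.mem_closure_iff.mp hmem (1 / 2 * ‖y‖) (by positivity)
    exact ⟨x, by rw [← dist_eq_norm]; exact hxy.le, by simpa using hx⟩
  by_contra hmem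
  have hconv : Convex ℝ (closure (T '' Metric.closedBall 0 (C * ‖y‖))) :=
    ((convex_closedBall (0 : X) _).is_linear_image
      (T.restrictScalars ℝ).toLinearMap.isLinear).closure
  -- Separate y from the image of the ball. The bound on the ball forces ‖ψ ∘ T‖ C‖y‖ ≤ u, whereas
  -- ψ', equal to ψ on the closed range, forces ‖ψ y‖ ≤ ‖ψ ∘ T‖ C‖y‖.
  obtain ⟨ψ, u, hψ, hu⟩ := RCLike.geometric_hahn_banach_closed_point (𝕜 := ℂ) hconv
    isClosed_closure hmem
  obtain ⟨ψ', hψ', hbound⟩ := h ψ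
  have hagree : ψ' y = ψ y := by
    refine closure_minimal (s := Set.range T) (t := {z | ψ' z = ψ z}) ?_
      (isClosed_eq ψ'.continuous ψ.continuous) hy
    rintro _ ⟨x, rfl⟩
    exact DFunLike.congr_fun hψ' x
  have hnorm : ‖ψ.comp T‖ * (C * ‖y‖) ≤ u := by
    have hr : 0 < C * ‖y‖ := by positivity
    have hu0 : 0 ≤ u := by
      have := hψ 0 (subset_closure ⟨0, by simp [hr.le], by simp⟩)
      simpa using this.le
    rw [← le_div_iff₀ hr]
    refine ContinuousLinearMap.opNorm_le_of_unit_norm (div_nonneg hu0 hr.le) fun x hx ↦ ?_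
    rw [le_div_iff₀ hr]
    -- The phase c makes ψ(T x) real and nonnegative, so a bound on real parts bounds the norm.
    obtain ⟨c, hc, hcx⟩ := RCLike.exists_norm_eq_mul_self (ψ (T x))
    have hmem' : ((C * ‖y‖ : ℝ) * c : ℂ) • x ∈ Metric.closedBall (0 : X) (C * ‖y‖) := by
      rw [mem_closedBall_zero_iff, norm_smul, norm_mul, hc, hx, Complex.norm_real,
        Real.norm_of_nonneg hr.le, mul_one, mul_one]
    have := hψ _ (subset_closure ⟨_, hmem', rfl⟩)
    rw [map_smul, map_smul, smul_eq_mul, mul_assoc, ← hcx] at this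
    change ((((C * ‖y‖ : ℝ) : ℂ) * ((‖ψ (T x)‖ : ℝ) : ℂ))).re < u at this
    rw [← Complex.ofReal_mul, Complex.ofReal_re, mul_comm] at this
    exact this.le
  have h₁ : ‖ψ y‖ ≤ ‖ψ.comp T‖ * (C * ‖y‖) := calc
    ‖ψ y‖ = ‖ψ' y‖ := by rw [hagree]
    _ ≤ ‖ψ'‖ * ‖y‖ := ψ'.le_opNorm y
    _ ≤ C * ‖ψ.comp T‖ * ‖y‖ := by gcongr
    _ = ‖ψ.comp T‖ * (C * ‖y‖) := by ring
  have h₂ : u < ‖ψ y‖ := hu.trans_le (RCLike.re_le_norm _)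
  linarith

/-- A functional separating x from the range of S is bounded above in real part on a subspace, so it
vanishes there; then it factors through T and vanishes at x as well. -/
theorem mem_closure_range_of_dual_exact {S : W →L[ℂ] X} {T : X →L[ℂ] Y}
    (h : ∀ χ : StrongDual ℂ X, χ.comp S = 0 → ∃ ψ : StrongDual ℂ Y, χ = ψ.comp T) {x : X}
    (hx : T x = 0) : x ∈ closure (Set.range S) := by
  by_contra hmem
  have hconv : Convex ℝ (closure (Set.range S)) := by
    have := (S.restrictScalars ℝ).range.convex.closure
    exact this
  obtain ⟨χ, u, hχ, hu⟩ := RCLike.geometric_hahn_banach_closed_point (𝕜 := ℂ) hconv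
    isClosed_closure hmem
  have hχS : χ.comp S = 0 := by
    ext w
    by_contra hw
    have hw' : χ (S w) ≠ 0 := hw
    -- The scalar is chosen so that χ takes exactly the value u, against the strict inequality.
    have := hχ _ (subset_closure ⟨((u : ℂ) / χ (S w)) • w, rfl⟩)
    rw [map_smul, map_smul, smul_eq_mul, div_mul_cancel₀ _ hw'] at this
    exact lt_irrefl _ this
  obtain ⟨ψ, rfl⟩ := h χ hχS
  have h0 := hχ _ (subset_closure ⟨0, rfl⟩)
  rw [map_zero, map_zero] at h0
  rw [comp_apply, hx, map_zero] at hu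
  exact lt_asymm h0 hu

/-- Dual exactness identifies the range of the adjoint of T with the kernel of the adjoint of S, a
Banach space. The open mapping theorem then bounds preimages under the adjoint, which is the bound
that yields approximate preimages under T. -/
theorem isClosed_range_of_dual_exact [CompleteSpace X] {S : W →L[ℂ] X} {T : X →L[ℂ] Y}
    (hTS : T.comp S = 0)
    (h : ∀ χ : StrongDual ℂ X, χ.comp S = 0 → ∃ ψ : StrongDual ℂ Y, χ = ψ.comp T) :
    IsClosed (Set.range T) := by
  let S' : StrongDual ℂ X →L[ℂ] StrongDual ℂ W := (ContinuousLinearMap.compL ℂ W X ℂ).flip S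
  let T' : StrongDual ℂ Y →L[ℂ] StrongDual ℂ X := (ContinuousLinearMap.compL ℂ X Y ℂ).flip T
  have hK : IsClosed (S'.ker : Set (StrongDual ℂ X)) := S'.isClosed_ker
  let T'' : StrongDual ℂ Y →L[ℂ] S'.ker := T'.codRestrict S'.ker fun ψ ↦ by
    have : (ψ.comp T).comp S = 0 := by rw [ContinuousLinearMap.comp_assoc, hTS, comp_zero]
    exact this
  have : CompleteSpace S'.ker := hK.completeSpace_coe
  have hsurj : Function.Surjective T'' := by
    rintro ⟨χ, hχ⟩
    obtain ⟨ψ, hψ⟩ := h χ hχ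
    exact ⟨ψ, Subtype.ext hψ.symm⟩
  obtain ⟨C, hC, hpre⟩ := ContinuousLinearMap.exists_preimage_norm_le (σ := RingHom.id ℂ)
    (σ' := RingHom.id ℂ) (E := StrongDual ℂ Y) (F := S'.ker) (f := T'') hsurj
  refine T.isClosed_range_of_approx_preimage C fun y hy ↦
    T.exists_approx_preimage_of_dual_bound hC (fun ψ ↦ ?_) y hy
  obtain ⟨ψ', hψ', hb⟩ := hpre (T'' ψ)
  exact ⟨ψ', congrArg Subtype.val hψ', hb⟩

/-- As χ kills ker T, it descends to the range of T. It is continuous there because T is open onto a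
closed, hence complete, range; Hahn–Banach extends it to Y. -/
theorem dual_exact_of_exact [CompleteSpace X] [CompleteSpace Y] {S : W →L[ℂ] X} {T : X →L[ℂ] Y}
    (h : ∀ x, T x = 0 → x ∈ Set.range S) (hT : IsClosed (Set.range T)) (χ : StrongDual ℂ X)
    (hχ : χ.comp S = 0) : ∃ ψ : StrongDual ℂ Y, χ = ψ.comp T := by
  have : CompleteSpace T.range := (show IsClosed (T.range : Set Y) from hT).completeSpace_coe
  let T' : X →L[ℂ] T.range := T.rangeRestrict
  have hsurj : Function.Surjective T' := by
    rintro ⟨_, x, rfl⟩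
    exact ⟨x, rfl⟩
  have hker : T'.toLinearMap.ker ≤ χ.toLinearMap.ker := by
    intro x hx
    obtain ⟨w, rfl⟩ := h x (congrArg Subtype.val hx)
    exact DFunLike.congr_fun hχ w
  let g : T.range →ₗ[ℂ] ℂ := (T'.toLinearMap.ker.liftQ χ.toLinearMap hker) ∘ₗ
    (T'.toLinearMap.quotKerEquivOfSurjective hsurj).symm.toLinearMap
  have hg (x : X) : g (T' x) = χ x := by
    have : (T'.toLinearMap.quotKerEquivOfSurjective hsurj).symm (T' x) =
        Submodule.Quotient.mk x := by
      rw [LinearEquiv.symm_apply_eq]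
      rfl
    simp only [g, LinearMap.comp_apply, LinearEquiv.coe_coe, this]
    rfl
  have hgc : Continuous g := by
    rw [(ContinuousLinearMap.isQuotientMap (F := T.range) T' hsurj).continuous_iff]
    exact χ.continuous.congr fun x ↦ (hg x).symm
  obtain ⟨ψ, hψ, -⟩ := exists_extension_norm_eq T.range (⟨g, hgc⟩ : StrongDual ℂ T.range)
  exact ⟨ψ, ContinuousLinearMap.ext fun x ↦ ((hψ (T' x)).trans (hg x)).symm⟩

end ContinuousLinearMap

end Banach

/-! ### The perfect pairing of complementary exterior powers. -/

namespace exteriorPower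

section Field

variable {K M M' : Type*} [Field K] [AddCommGroup M] [Module K M] [AddCommGroup M'] [Module K M']

/-- Euler's identity `∑ bᵢ ∧ (bᵢ* ⌋ v) = p v` in the exterior power of degree `p`. -/
theorem sum_ι_mul_contractLeft {I : Type*} [Fintype I] (b : Module.Basis I K M) {p : ℕ}
    (v : ⋀[K]^p M) :
    ∑ i, ExteriorAlgebra.ι K (b i) *
      CliffordAlgebra.contractLeft (Q := 0) (b.coord i) (v : ExteriorAlgebra K M) =
      (p : K) • (v : ExteriorAlgebra K M) := by
  let euler : ExteriorAlgebra K M →ₗ[K] ExteriorAlgebra K M :=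
    ∑ i, LinearMap.mulLeft K (ExteriorAlgebra.ι K (b i)) ∘ₗ
      CliffordAlgebra.contractLeft (Q := 0) (b.coord i)
  have heuler (x : ExteriorAlgebra K M) : euler x = ∑ i, ExteriorAlgebra.ι K (b i) *
      CliffordAlgebra.contractLeft (Q := 0) (b.coord i) x := by
    simp [euler]
  rw [← heuler]
  suffices euler ∘ₗ (⋀[K]^p M).subtype = (p : K) • (⋀[K]^p M).subtype from
    LinearMap.congr_fun this v
  induction p with
  | zero =>
    ext x
    have : (ExteriorAlgebra.ιMulti K 0 x : ExteriorAlgebra K M) = 1 := by simp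
    simp [heuler, this]
  | succ p ih =>
    refine wedge_ext fun z w ↦ ?_
    have ihw := LinearMap.congr_fun (ih w) w
    simp only [LinearMap.comp_apply, Submodule.subtype_apply, LinearMap.smul_apply, heuler] at ihw
    simp only [LinearMap.comp_apply, Submodule.subtype_apply, LinearMap.smul_apply, heuler,
      coe_wedge]
    have hterm (i : I) : ExteriorAlgebra.ι K (b i) *
        CliffordAlgebra.contractLeft (Q := 0) (b.coord i) (ExteriorAlgebra.ι K z * w) =
        ExteriorAlgebra.ι K (b.repr z i • b i) * w + ExteriorAlgebra.ι K z *
          (ExteriorAlgebra.ι K (b i) *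
            CliffordAlgebra.contractLeft (Q := 0) (b.coord i) (w : ExteriorAlgebra K M)) := by
      have hc := CliffordAlgebra.contractLeft_ι_mul (Q := (0 : QuadraticForm K M)) (d := b.coord i)
        z (w : ExteriorAlgebra K M)
      have hanti : ExteriorAlgebra.ι K (b i) * ExteriorAlgebra.ι K z =
          -(ExteriorAlgebra.ι K z * ExteriorAlgebra.ι K (b i)) :=
        eq_neg_of_add_eq_zero_left (ExteriorAlgebra.ι_add_mul_swap _ _)
      erw [hc]
      rw [mul_sub, ← mul_assoc _ (CliffordAlgebra.ι 0 z)]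
      erw [hanti]
      simp [mul_assoc]
    rw [Finset.sum_congr rfl fun i _ ↦ hterm i, Finset.sum_add_distrib, ← Finset.sum_mul,
      ← map_sum, b.sum_repr, ← Finset.mul_sum, ihw]
    rw [mul_smul_comm, Nat.cast_succ, add_smul, one_smul, add_comm]

/-- Contracting b_i ∧ v = 0 with b_i* gives b_i ∧ (b_i* ⌋ v) = v for every i. Euler's identity then
reads nv = pv with n = dim M ≠ p. -/
theorem eq_zero_of_forall_wedge_eq_zero [CharZero K] [FiniteDimensional K M] {p : ℕ}
    (hp : p < Module.finrank K M) (v : ⋀[K]^p M) (hv : ∀ y, wedge K M p y v = 0) : v = 0 := by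
  let b := Module.finBasis K M
  have h := sum_ι_mul_contractLeft b v
  have hterm (i) : ExteriorAlgebra.ι K (b i) *
      CliffordAlgebra.contractLeft (Q := 0) (b.coord i) (v : ExteriorAlgebra K M) = v := by
    have hc := CliffordAlgebra.contractLeft_ι_mul (Q := (0 : QuadraticForm K M)) (d := b.coord i)
      (b i) (v : ExteriorAlgebra K M)
    have h0 : ExteriorAlgebra.ι K (b i) * (v : ExteriorAlgebra K M) = 0 := by
      rw [← coe_wedge, hv]; rfl
    erw [h0, map_zero] at hc
    simp only [Module.Basis.coord_apply, Module.Basis.repr_self, Finsupp.single_eq_same,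
      one_smul] at hc
    exact (sub_eq_zero.mp hc.symm).symm
  rw [Finset.sum_congr rfl fun i _ ↦ hterm i, Finset.sum_const, Finset.card_univ,
    Fintype.card_fin, ← Nat.cast_smul_eq_nsmul K, ← sub_eq_zero, ← sub_smul, smul_eq_zero,
    sub_eq_zero, Nat.cast_inj] at h
  exact Subtype.ext (h.resolve_left hp.ne')

/-- The pairing `(v, w) ↦ ω(v ∧ o(w))` of exterior powers. -/
noncomputable def wedgePairing (ω : ExteriorAlgebra K M →ₗ[K] K) (o : M' →ₗ[K] M) (p q : ℕ) :
    ⋀[K]^p M →ₗ[K] ⋀[K]^q M' →ₗ[K] K :=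
  ((LinearMap.mul K (ExteriorAlgebra K M)).compr₂ ω).compl₁₂ (⋀[K]^p M).subtype
    ((ExteriorAlgebra.map o).toLinearMap ∘ₗ (⋀[K]^q M').subtype)

variable (ω : ExteriorAlgebra K M →ₗ[K] K) (o : M' →ₗ[K] M)

theorem wedgePairing_apply {p q : ℕ} (v : ⋀[K]^p M) (w : ⋀[K]^q M') :
    wedgePairing ω o p q v w = ω (v * ExteriorAlgebra.map o w) := rfl

theorem coe_mul_ι {p : ℕ} (v : ⋀[K]^p M) (y : M) :
    (v : ExteriorAlgebra K M) * ExteriorAlgebra.ι K y =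
      (-1 : K) ^ p • (ExteriorAlgebra.ι K y * v) := by
  suffices LinearMap.mulRight K (ExteriorAlgebra.ι K y) ∘ₗ (⋀[K]^p M).subtype =
      (-1 : K) ^ p • (LinearMap.mulLeft K (ExteriorAlgebra.ι K y) ∘ₗ (⋀[K]^p M).subtype) from
    LinearMap.congr_fun this v
  induction p with
  | zero => ext x; simp
  | succ p ih =>
    refine wedge_ext fun z w ↦ ?_
    have ihw := LinearMap.congr_fun (ih w) w
    simp only [LinearMap.comp_apply, Submodule.subtype_apply, LinearMap.smul_apply,
      LinearMap.mulLeft_apply, LinearMap.mulRight_apply] at ihw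
    have hanti : ExteriorAlgebra.ι K z * ExteriorAlgebra.ι K y =
        -(ExteriorAlgebra.ι K y * ExteriorAlgebra.ι K z) :=
      eq_neg_of_add_eq_zero_left (ExteriorAlgebra.ι_add_mul_swap _ _)
    simp only [LinearMap.comp_apply, Submodule.subtype_apply, LinearMap.smul_apply,
      LinearMap.mulLeft_apply, LinearMap.mulRight_apply, coe_wedge]
    rw [mul_assoc, ihw, mul_smul_comm, ← mul_assoc, hanti, pow_succ, mul_neg_one, neg_smul,
      neg_mul, smul_neg, mul_assoc]

theorem wedgePairing_wedge {p q : ℕ} (y : M') (v : ⋀[K]^p M) (w : ⋀[K]^q M') :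
    wedgePairing ω o (p + 1) q (wedge K M p (o y) v) w =
      (-1) ^ p * wedgePairing ω o p (q + 1) v (wedge K M' q y w) := by
  have h : (-1 : K) ^ p * (-1) ^ p = 1 := by rw [← mul_pow]; simp
  rw [wedgePairing_apply, wedgePairing_apply, coe_wedge, coe_wedge,
    map_mul (ExteriorAlgebra.map o),
    ExteriorAlgebra.map_apply_ι, ← mul_assoc (v : ExteriorAlgebra K M), coe_mul_ι,
    smul_mul_assoc, map_smul, smul_eq_mul, ← mul_assoc, h, one_mul]

/-- Invariance of the pairing. Since S corresponds to -T, the difference of the two sides comes from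
a derivation of the top power, which is zero. The induction moves the factors of v one at a time to
the right, until w has top degree. -/
theorem wedgePairing_derivationOf (ho : Function.Surjective o) {n : ℕ} (S : M →ₗ[K] M)
    (T : M' →ₗ[K] M') (hST : ∀ y, o (T y) = -S (o y)) (hT : derivationOf T n = 0) {p q : ℕ}
    (hpq : p + q = n) (v : ⋀[K]^p M) (w : ⋀[K]^q M') :
    wedgePairing ω o p q (derivationOf S p v) w = wedgePairing ω o p q v (derivationOf T q w) := by
  induction p generalizing q with
  | zero =>
    obtain rfl : q = n := by omega
    rw [hT, derivationOf_zero]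
    simp
  | succ p ih =>
    suffices (wedgePairing ω o (p + 1) q).flip w ∘ₗ derivationOf S (p + 1) =
        (wedgePairing ω o (p + 1) q).flip (derivationOf T q w) from LinearMap.congr_fun this v
    refine wedge_ext fun y v ↦ ?_
    obtain ⟨y, rfl⟩ := ho y
    have hS : S (o y) = o (-T y) := by rw [map_neg, hST, neg_neg]
    simp only [LinearMap.comp_apply, LinearMap.flip_apply, derivationOf_wedge, map_add, hS,
      wedgePairing_wedge]
    rw [ih (by omega), derivationOf_wedge, map_neg, LinearMap.neg_apply, map_add, map_neg]
    ring

/-- Moving a factor across shows that every y ∧ w is in the radical one degree higher, so it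
vanishes by induction; hence so does w. -/
theorem eq_zero_of_forall_wedgePairing_eq_zero [CharZero K] [FiniteDimensional K M']
    (hω : ∀ w : ⋀[K]^(Module.finrank K M') M', ω (ExteriorAlgebra.map o w) = 0 → w = 0)
    {p q : ℕ} (hpq : p + q = Module.finrank K M') (w : ⋀[K]^q M')
    (hw : ∀ v, wedgePairing ω o p q v w = 0) : w = 0 := by
  induction p generalizing q with
  | zero =>
    obtain rfl : q = Module.finrank K M' := by omega
    refine hω w ?_
    simpa [wedgePairing_apply] using hw (ιMulti K 0 ![])
  | succ p ih =>
    refine eq_zero_of_forall_wedge_eq_zero (by omega) w fun y ↦ ih (by omega) _ fun v ↦ ?_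
    have := hw (wedge K M p (o y) v)
    rw [wedgePairing_wedge] at this
    exact (mul_eq_zero.mp this).resolve_left (pow_ne_zero _ (by simp))

/-- The determinant on the top power, extended arbitrarily to the whole exterior algebra. Defining ω
there lets the pairing use the algebra product, without identifying degree p + q with n. -/
theorem exists_top_functional [FiniteDimensional K M'] (o : M' ≃ₗ[K] M) :
    ∃ ω : ExteriorAlgebra K M →ₗ[K] K, ∀ w : ⋀[K]^(Module.finrank K M') M',
      ω (ExteriorAlgebra.map o.toLinearMap w) = 0 → w = 0 := by
  let n := Module.finrank K M'
  let b := Module.finBasis K M'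
  let α : ⋀[K]^n M' →ₗ[K] K := alternatingMapLinearEquiv b.det
  have hα : Function.Injective α := by
    rw [LinearMap.injective_iff_surjective_of_finrank_eq_finrank
      (by rw [finrank_eq, Nat.choose_self, Module.finrank_self])]
    refine LinearMap.surjective fun h ↦ ?_
    have := LinearMap.congr_fun h (ιMulti K n b)
    exact b.det_ne_zero (by simpa [α] using this)
  obtain ⟨β, hβ⟩ := α.exists_extend
  refine ⟨β ∘ₗ (ExteriorAlgebra.map o.symm.toLinearMap).toLinearMap, fun w hw ↦ hα ?_⟩
  rw [map_zero, ← hw, ← hβ]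
  have : ExteriorAlgebra.map o.symm.toLinearMap (ExteriorAlgebra.map o.toLinearMap
      (w : ExteriorAlgebra K M')) = w := by
    rw [← AlgHom.comp_apply, ExteriorAlgebra.map_comp_map]
    simp
  simp [this]

theorem wedgePairing_flip_bijective [CharZero K] [FiniteDimensional K M] [FiniteDimensional K M']
    (hω : ∀ w : ⋀[K]^(Module.finrank K M') M', ω (ExteriorAlgebra.map o w) = 0 → w = 0)
    (hM : Module.finrank K M = Module.finrank K M')
    {p q : ℕ} (hpq : p + q = Module.finrank K M') :
    Function.Bijective (wedgePairing ω o p q).flip := by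
  have hinj : Function.Injective (wedgePairing ω o p q).flip := by
    refine (injective_iff_map_eq_zero _).mpr fun w hw ↦ ?_
    exact eq_zero_of_forall_wedgePairing_eq_zero ω o hω hpq w fun v ↦ LinearMap.congr_fun hw v
  refine ⟨hinj, (LinearMap.injective_iff_surjective_of_finrank_eq_finrank ?_).mp hinj⟩
  rw [Subspace.dual_finrank_eq, finrank_eq, finrank_eq, hM]
  exact Nat.choose_symm_of_eq_add (by omega)

end Field

end exteriorPower

namespace exteriorPower

variable {K M : Type*} [Field K] [AddCommGroup M] [Module K M]

theorem subsingleton_of_finrank_lt [FiniteDimensional K M] {p : ℕ} (hp : Module.finrank K M < p) :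
    Subsingleton (⋀[K]^p M) := by
  rw [← Module.finrank_zero_iff (R := K), finrank_eq]
  exact Nat.choose_eq_zero_of_lt hp

end exteriorPower

/-! ### Traces of adjoint maps. -/

namespace LieOpposite

variable {L : Type*} [LieRing L] [LieAlgebra ℂ L]

instance [FiniteDimensional ℂ L] : FiniteDimensional ℂ (LieOpposite L) :=
  Module.Finite.equiv (of L)

theorem trace_ad_of (y : L) : LinearMap.trace ℂ _ (LieAlgebra.ad ℂ (LieOpposite L) (of L y)) =
    -LinearMap.trace ℂ L (LieAlgebra.ad ℂ L y) := by
  have : LieAlgebra.ad ℂ (LieOpposite L) (of L y) = -((of L).conj (LieAlgebra.ad ℂ L y)) := by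
    ext z
    obtain ⟨z, rfl⟩ := (of L).surjective z
    simp only [LieAlgebra.ad_apply, LinearMap.neg_apply, LinearEquiv.conj_apply,
      LinearMap.comp_apply, LinearEquiv.coe_coe, LinearEquiv.symm_apply_apply]
    rw [← of_lie, ← lie_skew, map_neg]
  rw [this, map_neg, LinearMap.trace_conj']

end LieOpposite

/-- The only place where nilpotency of L enters; the rest of the argument needs just these traces to
vanish. -/
theorem LieAlgebra.trace_ad_eq_zero {L : Type*} [LieRing L] [LieAlgebra ℂ L]
    [FiniteDimensional ℂ L] [LieRing.IsNilpotent L] (y : L) :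
    LinearMap.trace ℂ L (LieAlgebra.ad ℂ L y) = 0 :=
  (LinearMap.isNilpotent_trace_of_isNilpotent
    (LieModule.isNilpotent_toEnd_of_isNilpotent ℂ L L y)).eq_zero

/-! ### Poincaré duality between the complexes of L and L'. -/

namespace LieComplex

open exteriorPower

section Functional

variable {E N : Type*} [NormedAddCommGroup E] [NormedSpace ℂ E] [AddCommGroup N] [Module ℂ N]

variable (E N) in
/-- The functional `e ⊗ m ↦ ψ(m)(e)` on `E ⊗ N` given by `ψ : N → E*`. -/
noncomputable def functionalOf :
    (N →ₗ[ℂ] StrongDual ℂ E) →ₗ[ℂ] (E ⊗[ℂ] N →ₗ[ℂ] ℂ) where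
  toFun ψ := TensorProduct.lift ((ContinuousLinearMap.coeLM ℂ ∘ₗ ψ).flip)
  map_add' _ _ := TensorProduct.ext' fun e m ↦ by simp
  map_smul' _ _ := TensorProduct.ext' fun e m ↦ by simp

theorem functionalOf_tmul (ψ : N →ₗ[ℂ] StrongDual ℂ E) (e : E) (m : N) :
    functionalOf E N ψ (e ⊗ₜ m) = ψ m e := by
  simp [functionalOf]

theorem functionalOf_injective : Function.Injective (functionalOf E N) := by
  intro ψ ψ' h
  ext m e
  rw [← functionalOf_tmul, h, functionalOf_tmul]

end Functional

section Duality

variable {L E : Type*} [LieRing L] [LieAlgebra ℂ L] [NormedAddCommGroup E] [NormedSpace ℂ E]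
  (ω : ExteriorAlgebra ℂ L →ₗ[ℂ] ℂ)

variable (E) in
/-- The map `φ ⊗ w ↦ (v ↦ ω(v ∧ w) φ)`. -/
noncomputable def poincare (p q : ℕ) :
    StrongDual ℂ E ⊗[ℂ] ⋀[ℂ]^q (LieOpposite L) →ₗ[ℂ] (⋀[ℂ]^p L →ₗ[ℂ] StrongDual ℂ E) :=
  dualTensorHom ℂ (⋀[ℂ]^p L) (StrongDual ℂ E) ∘ₗ
    LinearMap.rTensor _ (wedgePairing ω (LieOpposite.of L).symm.toLinearMap p q).flip ∘ₗ
      (TensorProduct.comm ℂ _ _).toLinearMap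

theorem poincare_tmul {p q : ℕ} (φ : StrongDual ℂ E) (w : ⋀[ℂ]^q (LieOpposite L))
    (v : ⋀[ℂ]^p L) : poincare E ω p q (φ ⊗ₜ w) v =
      wedgePairing ω (LieOpposite.of L).symm.toLinearMap p q v w • φ := by
  simp [poincare]

theorem functionalOf_poincare_tmul {p q : ℕ} (φ : StrongDual ℂ E) (w : ⋀[ℂ]^q (LieOpposite L))
    (e : E) (v : ⋀[ℂ]^p L) : functionalOf E _ (poincare E ω p q (φ ⊗ₜ w)) (e ⊗ₜ v) =
      wedgePairing ω (LieOpposite.of L).symm.toLinearMap p q v w * φ e := by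
  rw [functionalOf_tmul, poincare_tmul]
  rfl

theorem functionalOf_poincare_tensorWedge {p q : ℕ} (y : L)
    (c' : StrongDual ℂ E ⊗[ℂ] ⋀[ℂ]^q (LieOpposite L)) (c : E ⊗[ℂ] ⋀[ℂ]^p L) :
    functionalOf E _ (poincare E ω (p + 1) q c') (tensorWedge L E p y c) =
      (-1) ^ p * functionalOf E _ (poincare E ω p (q + 1)
        (tensorWedge (LieOpposite L) (StrongDual ℂ E) q (LieOpposite.of L y) c')) c := by
  induction c' with
  | zero => simp
  | add a b ha hb => simp only [map_add, LinearMap.add_apply, ha, hb, mul_add]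
  | tmul φ w =>
    induction c with
    | zero => simp
    | add a b ha hb => simp only [map_add, ha, hb, mul_add]
    | tmul e v =>
      have := wedgePairing_wedge ω (LieOpposite.of L).symm.toLinearMap (LieOpposite.of L y) v w
      rw [LinearEquiv.coe_coe, LinearEquiv.symm_apply_apply] at this
      rw [tensorWedge_tmul, tensorWedge_tmul, functionalOf_poincare_tmul,
        functionalOf_poincare_tmul, this, mul_assoc]

variable (ρ : RightAction L E) (f : Module.Dual ℂ L)

variable [FiniteDimensional ℂ L]

/-- On the Banach factor this is the definition of the adjoint; on the exterior factor it is the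
invariance of the pairing. -/
theorem functionalOf_poincare_tensorAction (hL : ∀ y, LinearMap.trace ℂ L (LieAlgebra.ad ℂ L y) = 0)
    {p q : ℕ} (hpq : p + q = Module.finrank ℂ L) (y : L)
    (c' : StrongDual ℂ E ⊗[ℂ] ⋀[ℂ]^q (LieOpposite L)) (c : E ⊗[ℂ] ⋀[ℂ]^p L) :
    functionalOf E _ (poincare E ω p q c') (tensorAction ρ f p y c) =
      functionalOf E _ (poincare E ω p q (tensorAction ρ.dual
        (f ∘ₗ (LieOpposite.of L).symm.toLinearMap) q (LieOpposite.of L y) c')) c := by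
  induction c' with
  | zero => simp
  | add a b ha hb => simp only [map_add, LinearMap.add_apply, ha, hb]
  | tmul φ w =>
    induction c with
    | zero => simp
    | add a b ha hb => simp only [map_add, ha, hb]
    | tmul e v =>
      have hT : derivationOf (-(LieAlgebra.ad ℂ (LieOpposite L) (LieOpposite.of L y)))
          (Module.finrank ℂ L) = 0 :=
        derivationOf_eq_zero_of_trace_eq_zero
          ((Module.finBasis ℂ L).map (LieOpposite.of L)) _
          (by rw [map_neg, LieOpposite.trace_ad_of, hL, neg_zero, neg_zero])
      have := wedgePairing_derivationOf ω (LieOpposite.of L).symm.toLinearMap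
        (LieOpposite.of L).symm.surjective (-(LieAlgebra.ad ℂ L y)) _ (fun z ↦ by
          obtain ⟨z, rfl⟩ := (LieOpposite.of L).surjective z
          simp only [LinearMap.neg_apply, LieAlgebra.ad_apply, LinearEquiv.coe_coe,
            ← LieOpposite.of_lie, map_neg, LinearEquiv.symm_apply_apply]
          rw [← lie_skew, neg_neg]) hT hpq v w
      simp only [tensorAction_tmul, map_add, LinearMap.add_apply, functionalOf_poincare_tmul, this,
        sub_apply, smul_apply, map_sub, map_smul,
        ρ.dual_operator_apply, LinearMap.comp_apply, LinearEquiv.coe_coe,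
        LinearEquiv.symm_apply_apply]

/-- Both differentials obey Cartan's formula, while multiplications and actions are already
transposed to each other, so induction on p transposes d. -/
theorem functionalOf_poincare_d (hL : ∀ y, LinearMap.trace ℂ L (LieAlgebra.ad ℂ L y) = 0)
    {p q : ℕ} (hpq : p + q + 1 = Module.finrank ℂ L)
    (c' : StrongDual ℂ E ⊗[ℂ] ⋀[ℂ]^(q + 1) (LieOpposite L)) (c : E ⊗[ℂ] ⋀[ℂ]^(p + 1) L) :
    functionalOf E _ (poincare E ω p (q + 1) c') (d ρ f p c) =
      (-1) ^ p * functionalOf E _ (poincare E ω (p + 1) q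
        (d ρ.dual (f ∘ₗ (LieOpposite.of L).symm.toLinearMap) q c')) c := by
  suffices functionalOf E _ (poincare E ω p (q + 1) c') ∘ₗ d ρ f p =
      (-1 : ℂ) ^ p • functionalOf E _ (poincare E ω (p + 1) q
        (d ρ.dual (f ∘ₗ (LieOpposite.of L).symm.toLinearMap) q c')) from LinearMap.congr_fun this c
  have hsign (p : ℕ) : (-1 : ℂ) ^ p * (-1) ^ p = 1 := by rw [← mul_pow]; simp
  induction p generalizing q with
  | zero =>
    refine tensorWedge_ext fun y c ↦ ?_
    -- Here c' has top degree, so y ∧ c' = 0 and Cartan's formula reduces to θ_y c' = y ∧ dc'.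
    have : Subsingleton (⋀[ℂ]^(q + 2) (LieOpposite L)) := subsingleton_of_finrank_lt (by
      rw [← (LieOpposite.of L).finrank_eq]; omega)
    have hd := d_succ_tensorWedge ρ.dual (f ∘ₗ (LieOpposite.of L).symm.toLinearMap)
      (LieOpposite.of L y) c'
    rw [Subsingleton.elim (tensorWedge _ _ _ _ c') 0, map_zero, eq_comm, sub_eq_zero] at hd
    rw [LinearMap.comp_apply, d_zero_tensorWedge,
      functionalOf_poincare_tensorAction ω ρ f hL (by omega), hd, LinearMap.smul_apply,
      functionalOf_poincare_tensorWedge]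
    simp
  | succ p ih =>
    refine tensorWedge_ext fun y c ↦ ?_
    have ih' := LinearMap.congr_fun (ih (q := q + 1) (by omega) (tensorWedge _ _ _
      (LieOpposite.of L y) c') c) c
    rw [LinearMap.comp_apply, LinearMap.smul_apply, smul_eq_mul] at ih'
    rw [LinearMap.comp_apply, d_succ_tensorWedge, map_sub,
      functionalOf_poincare_tensorAction ω ρ f hL (by omega), LinearMap.smul_apply,
      functionalOf_poincare_tensorWedge, functionalOf_poincare_tensorWedge, ih',
      d_succ_tensorWedge, smul_eq_mul, ← mul_assoc, ← mul_assoc, hsign, hsign, map_sub, map_sub,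
      LinearMap.sub_apply]
    ring

variable (E) in
theorem poincare_bijective (hω : ∀ w : ⋀[ℂ]^(Module.finrank ℂ (LieOpposite L)) (LieOpposite L),
    ω (ExteriorAlgebra.map (LieOpposite.of L).symm.toLinearMap w) = 0 → w = 0) {p q : ℕ}
    (hpq : p + q = Module.finrank ℂ L) : Function.Bijective (poincare E ω p q) := by
  have hL : Module.finrank ℂ L = Module.finrank ℂ (LieOpposite L) := (LieOpposite.of L).finrank_eq
  have hB := wedgePairing_flip_bijective ω _ hω hL (hL ▸ hpq)
  have : (LinearMap.rTensor (StrongDual ℂ E)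
      (wedgePairing ω (LieOpposite.of L).symm.toLinearMap p q).flip) =
      (TensorProduct.congr (LinearEquiv.ofBijective _ hB) (.refl ℂ _)).toLinearMap := by
    ext; simp
  simp only [poincare, this, LinearMap.coe_comp]
  exact (dualTensorHom_bijective ..).comp
    ((LinearEquiv.bijective _).comp (LinearEquiv.bijective _))

end Duality

end LieComplex

/-! ### Banach coordinates and the complex of continuous functionals. -/

namespace LieComplex

open exteriorPower

section Coordinates

variable (E N N' : Type*) [NormedAddCommGroup E] [NormedSpace ℂ E] [AddCommGroup N] [Module ℂ N]
  [FiniteDimensional ℂ N] [AddCommGroup N'] [Module ℂ N'] [FiniteDimensional ℂ N']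

/-- Coordinates on `E ⊗ N`, which make it a Banach space. -/
noncomputable def coordinates : E ⊗[ℂ] N ≃ₗ[ℂ] (Fin (Module.finrank ℂ N) → E) :=
  TensorProduct.congr (.refl ℂ E) (Module.finBasis ℂ N).equivFun ≪≫ₗ
    TensorProduct.piScalarRight ℂ ℂ E _

variable {E N N'}

theorem coordinates_tmul (e : E) (m : N) (i : Fin (Module.finrank ℂ N)) :
    coordinates E N (e ⊗ₜ m) i = (Module.finBasis ℂ N).repr m i • e := by
  simp [coordinates]

theorem coordinates_symm_apply (x : Fin (Module.finrank ℂ N) → E) :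
    (coordinates E N).symm x = ∑ i, x i ⊗ₜ Module.finBasis ℂ N i := by
  rw [LinearEquiv.symm_apply_eq]
  ext j
  simp [map_sum, coordinates_tmul, Finsupp.single_apply]

theorem continuous_coordinates_tmul {g : E → E} (hg : Continuous g) (m : N) :
    Continuous fun e ↦ coordinates E N (g e ⊗ₜ m) := by
  refine continuous_pi fun i ↦ ?_
  simp only [coordinates_tmul]
  exact hg.const_smul _

/-- A linear map between tensor products with `E`, as a bounded operator in coordinates. -/
noncomputable def toBounded (T : E ⊗[ℂ] N →ₗ[ℂ] E ⊗[ℂ] N')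
    (hT : ∀ m, Continuous fun e ↦ coordinates E N' (T (e ⊗ₜ m))) :
    (Fin (Module.finrank ℂ N) → E) →L[ℂ] (Fin (Module.finrank ℂ N') → E) where
  toLinearMap := (coordinates E N').toLinearMap ∘ₗ T ∘ₗ (coordinates E N).symm.toLinearMap
  cont := by
    have h (x : Fin (Module.finrank ℂ N) → E) :
        coordinates E N' (T ((coordinates E N).symm x)) =
        ∑ i, coordinates E N' (T (x i ⊗ₜ Module.finBasis ℂ N i)) := by
      rw [coordinates_symm_apply, map_sum, map_sum]
    exact (continuous_finsetSum _ fun i _ ↦ (hT _).comp (continuous_apply i)).congr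
      fun x ↦ (h x).symm

theorem toBounded_coordinates (T : E ⊗[ℂ] N →ₗ[ℂ] E ⊗[ℂ] N')
    (hT : ∀ m, Continuous fun e ↦ coordinates E N' (T (e ⊗ₜ m))) (c : E ⊗[ℂ] N) :
    toBounded T hT (coordinates E N c) = coordinates E N' (T c) := by
  change coordinates E N' (T ((coordinates E N).symm (coordinates E N c))) = _
  rw [LinearEquiv.symm_apply_apply]

/-- `functionalOf ψ`, as a bounded functional in coordinates. -/
noncomputable def boundedFunctional (ψ : N →ₗ[ℂ] StrongDual ℂ E) :
    StrongDual ℂ (Fin (Module.finrank ℂ N) → E) where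
  toLinearMap := functionalOf E N ψ ∘ₗ (coordinates E N).symm.toLinearMap
  cont := by
    have h (x : Fin (Module.finrank ℂ N) → E) :
        functionalOf E N ψ ((coordinates E N).symm x) =
        ∑ i, ψ (Module.finBasis ℂ N i) (x i) := by
      rw [coordinates_symm_apply, map_sum]
      simp only [functionalOf_tmul]
    exact (continuous_finsetSum _ fun i _ ↦ (ContinuousLinearMap.continuous _).comp
      (continuous_apply i)).congr fun x ↦ (h x).symm

theorem boundedFunctional_coordinates (ψ : N →ₗ[ℂ] StrongDual ℂ E) (c : E ⊗[ℂ] N) :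
    boundedFunctional ψ (coordinates E N c) = functionalOf E N ψ c := by
  change functionalOf E N ψ ((coordinates E N).symm (coordinates E N c)) = _
  rw [LinearEquiv.symm_apply_apply]

/-- Restricting χ to the slices e ↦ e ⊗ m recovers ψ. Thus Hom(N, E*) is the full topological dual
of E ⊗ N. -/
theorem exists_boundedFunctional_eq (χ : StrongDual ℂ (Fin (Module.finrank ℂ N) → E)) :
    ∃ ψ : N →ₗ[ℂ] StrongDual ℂ E, χ = boundedFunctional ψ := by
  let slice (m : N) : E →L[ℂ] (Fin (Module.finrank ℂ N) → E) :=
    { toLinearMap := (coordinates E N).toLinearMap ∘ₗ (TensorProduct.mk ℂ E N).flip m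
      cont := continuous_coordinates_tmul continuous_id m }
  have hslice (m : N) (e : E) : slice m e = coordinates E N (e ⊗ₜ m) := rfl
  let ψ : N →ₗ[ℂ] StrongDual ℂ E :=
    { toFun := fun m ↦ χ.comp (slice m)
      map_add' := fun m m' ↦ by ext e; simp [hslice, TensorProduct.tmul_add]
      map_smul' := fun a m ↦ by ext e; simp [hslice] }
  refine ⟨ψ, ContinuousLinearMap.ext fun x ↦ ?_⟩
  obtain ⟨c, rfl⟩ := (coordinates E N).surjective x
  rw [boundedFunctional_coordinates]
  induction c with
  | zero => simp
  | add a b ha hb => simp only [map_add, ha, hb]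
  | tmul e m => rw [functionalOf_tmul]; rfl

theorem boundedFunctional_comp_toBounded_eq_zero_iff (T : E ⊗[ℂ] N →ₗ[ℂ] E ⊗[ℂ] N')
    (hT : ∀ m, Continuous fun e ↦ coordinates E N' (T (e ⊗ₜ m))) (χ : N' →ₗ[ℂ] StrongDual ℂ E) :
    (boundedFunctional χ).comp (toBounded T hT) = 0 ↔ functionalOf E N' χ ∘ₗ T = 0 := by
  constructor <;> intro h
  · refine LinearMap.ext fun c ↦ ?_
    have := DFunLike.congr_fun h (coordinates E N c)
    rwa [ContinuousLinearMap.comp_apply, toBounded_coordinates,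
      boundedFunctional_coordinates] at this
  · ext1 x
    obtain ⟨c, rfl⟩ := (coordinates E N).surjective x
    rw [ContinuousLinearMap.comp_apply, toBounded_coordinates, boundedFunctional_coordinates]
    exact LinearMap.congr_fun h c

theorem boundedFunctional_eq_comp_toBounded_iff (T : E ⊗[ℂ] N →ₗ[ℂ] E ⊗[ℂ] N')
    (hT : ∀ m, Continuous fun e ↦ coordinates E N' (T (e ⊗ₜ m))) (χ : N →ₗ[ℂ] StrongDual ℂ E)
    (ψ : N' →ₗ[ℂ] StrongDual ℂ E) :
    boundedFunctional χ = (boundedFunctional ψ).comp (toBounded T hT) ↔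
      functionalOf E N χ = functionalOf E N' ψ ∘ₗ T := by
  constructor <;> intro h
  · refine LinearMap.ext fun c ↦ ?_
    have := DFunLike.congr_fun h (coordinates E N c)
    rwa [ContinuousLinearMap.comp_apply, toBounded_coordinates,
      boundedFunctional_coordinates, boundedFunctional_coordinates] at this
  · ext1 x
    obtain ⟨c, rfl⟩ := (coordinates E N).surjective x
    rw [ContinuousLinearMap.comp_apply, toBounded_coordinates, boundedFunctional_coordinates,
      boundedFunctional_coordinates]
    exact LinearMap.congr_fun h c

end Coordinates

variable {L E : Type*} [LieRing L] [LieAlgebra ℂ L] [FiniteDimensional ℂ L]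
  [NormedAddCommGroup E] [NormedSpace ℂ E] (ρ : RightAction L E) (f : Module.Dual ℂ L)

theorem continuous_coordinates_d (p : ℕ) (w : ⋀[ℂ]^(p + 1) L) :
    Continuous fun e ↦ coordinates E (⋀[ℂ]^p L) (d ρ f p (e ⊗ₜ w)) := by
  have hw : w ∈ Submodule.span ℂ (Set.range (ιMulti ℂ (p + 1) (M := L))) := by
    rw [ιMulti_span]; trivial
  induction hw using Submodule.span_induction with
  | mem w hw =>
    obtain ⟨v, rfl⟩ := hw
    simp only [d, LinearMap.add_apply, operatorPart_tmul_ιMulti, LinearMap.lTensor_tmul, map_add,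
      map_sum, map_zsmul]
    refine Continuous.add (continuous_finsetSum _ fun k _ ↦ Continuous.fun_const_smul ?_ _)
      (continuous_coordinates_tmul continuous_id _)
    exact continuous_coordinates_tmul (g := fun e ↦ ρ.operator (v k) e - f (v k) • e)
      (by fun_prop) _
  | zero => simpa using continuous_const
  | add a b _ _ ha hb => exact (ha.add hb).congr fun e ↦ by simp [TensorProduct.tmul_add]
  | smul c a _ ha => exact (ha.const_smul c).congr fun e ↦ by simp

/-- The differential as a bounded operator in coordinates. -/
noncomputable def boundedD (p : ℕ) : (Fin (Module.finrank ℂ (⋀[ℂ]^(p + 1) L)) → E) →L[ℂ]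
    (Fin (Module.finrank ℂ (⋀[ℂ]^p L)) → E) :=
  toBounded (d ρ f p) (continuous_coordinates_d ρ f p)

theorem boundedD_coordinates (p : ℕ) (c : E ⊗[ℂ] ⋀[ℂ]^(p + 1) L) :
    boundedD ρ f p (coordinates E _ c) = coordinates E _ (d ρ f p c) :=
  toBounded_coordinates _ _ c

theorem coordinates_mem_range_boundedD {p : ℕ} {c : E ⊗[ℂ] ⋀[ℂ]^p L} :
    coordinates E _ c ∈ Set.range (boundedD ρ f p) ↔ c ∈ LinearMap.range (d ρ f p) := by
  constructor
  · rintro ⟨x, hx⟩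
    obtain ⟨a, rfl⟩ := (coordinates E _).surjective x
    rw [boundedD_coordinates] at hx
    exact ⟨a, (coordinates E _).injective hx⟩
  · rintro ⟨a, rfl⟩
    exact ⟨_, boundedD_coordinates ρ f p a⟩

theorem boundedD_coordinates_eq_zero {p : ℕ} {c : E ⊗[ℂ] ⋀[ℂ]^(p + 1) L} :
    boundedD ρ f p (coordinates E _ c) = 0 ↔ d ρ f p c = 0 := by
  rw [boundedD_coordinates, LinearEquiv.map_eq_zero_iff]

theorem boundedD_comp_boundedD {f : Module.Dual ℂ L} (hf : ∀ x y : L, f ⁅x, y⁆ = 0) (p : ℕ) :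
    (boundedD ρ f p).comp (boundedD ρ f (p + 1)) = 0 := by
  ext1 x
  obtain ⟨c, rfl⟩ := (coordinates E _).surjective x
  rw [ContinuousLinearMap.comp_apply, boundedD_coordinates, boundedD_coordinates,
    show d ρ f p (d ρ f (p + 1) c) = 0 from LinearMap.congr_fun (d_comp_d ρ hf p) c, map_zero]
  rfl

/-- The coboundaries of the complex of the continuous functionals on `(E ⊗ ⋀ L, d(f))`. -/
def IsCoboundary : (p : ℕ) → (⋀[ℂ]^p L →ₗ[ℂ] StrongDual ℂ E) → Prop
  | 0, χ => χ = 0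
  | p + 1, χ => ∃ ψ : ⋀[ℂ]^p L →ₗ[ℂ] StrongDual ℂ E,
      functionalOf E _ χ = functionalOf E _ ψ ∘ₗ d ρ f p

variable {f} [CompleteSpace E]

theorem isCoboundary_of_exact (hf : ∀ x y : L, f ⁅x, y⁆ = 0)
    (h : ∀ p, cycles ρ f p ≤ LinearMap.range (d ρ f p)) (p : ℕ)
    (χ : ⋀[ℂ]^p L →ₗ[ℂ] StrongDual ℂ E) (hχ : functionalOf E _ χ ∘ₗ d ρ f p = 0) :
    IsCoboundary ρ f p χ := by
  cases p with
  | zero =>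
    refine functionalOf_injective (LinearMap.ext fun c ↦ ?_)
    obtain ⟨a, rfl⟩ := h 0 (show c ∈ cycles ρ f 0 from Submodule.mem_top)
    rw [map_zero]
    exact LinearMap.congr_fun hχ a
  | succ p =>
    -- Exactness one degree lower: the range is the whole space in degree 0 and otherwise the kernel
    -- of the next differential.
    have hclosed : IsClosed (Set.range (boundedD ρ f p)) := by
      cases p with
      | zero =>
        convert isClosed_univ
        rw [Set.range_eq_univ]
        intro x
        obtain ⟨c, rfl⟩ := (coordinates E _).surjective x
        exact (coordinates_mem_range_boundedD ρ f).mpr (h 0 Submodule.mem_top)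
      | succ p =>
        convert (boundedD ρ f p).isClosed_ker
        ext x
        obtain ⟨c, rfl⟩ := (coordinates E _).surjective x
        rw [coordinates_mem_range_boundedD]
        refine ⟨?_, fun hc ↦ h (p + 1) ((boundedD_coordinates_eq_zero ρ f).mp hc)⟩
        rintro ⟨a, rfl⟩
        exact (boundedD_coordinates_eq_zero ρ f).mpr (LinearMap.congr_fun (d_comp_d ρ hf p) a)
    obtain ⟨ψ, hψ⟩ := ContinuousLinearMap.dual_exact_of_exact (S := boundedD ρ f (p + 1))
      (T := boundedD ρ f p) (fun x hx ↦ by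
        obtain ⟨c, rfl⟩ := (coordinates E _).surjective x
        exact (coordinates_mem_range_boundedD ρ f).mpr
          (h (p + 1) ((boundedD_coordinates_eq_zero ρ f).mp hx)))
      hclosed (boundedFunctional χ) ((boundedFunctional_comp_toBounded_eq_zero_iff _ _ _).mpr hχ)
    obtain ⟨ψ, rfl⟩ := exists_boundedFunctional_eq ψ
    exact ⟨ψ, (boundedFunctional_eq_comp_toBounded_iff _ _ _ _).mp hψ⟩

/-- Dual exactness in degree p + 1 closes the range of the differential into degree p; in degree p
it makes that range dense in the cycles. -/
theorem exact_of_isCoboundary (hf : ∀ x y : L, f ⁅x, y⁆ = 0)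
    (h : ∀ p (χ : ⋀[ℂ]^p L →ₗ[ℂ] StrongDual ℂ E), functionalOf E _ χ ∘ₗ d ρ f p = 0 →
      IsCoboundary ρ f p χ) (p : ℕ) :
    cycles ρ f p ≤ LinearMap.range (d ρ f p) := by
  have hdual (p : ℕ) (χ : StrongDual ℂ (Fin (Module.finrank ℂ (⋀[ℂ]^(p + 1) L)) → E))
      (hχ : χ.comp (boundedD ρ f (p + 1)) = 0) :
      ∃ ψ : StrongDual ℂ (Fin (Module.finrank ℂ (⋀[ℂ]^p L)) → E),
        χ = ψ.comp (boundedD ρ f p) := by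
    obtain ⟨χ, rfl⟩ := exists_boundedFunctional_eq χ
    obtain ⟨ψ, hψ⟩ := h (p + 1) χ ((boundedFunctional_comp_toBounded_eq_zero_iff _ _ _).mp hχ)
    exact ⟨_, (boundedFunctional_eq_comp_toBounded_iff _ _ _ _).mpr hψ⟩
  have hclosed (p : ℕ) : IsClosed (Set.range (boundedD ρ f p)) :=
    ContinuousLinearMap.isClosed_range_of_dual_exact (boundedD_comp_boundedD ρ hf p) (hdual p)
  intro c hc
  rw [← coordinates_mem_range_boundedD, ← (hclosed p).closure_eq]
  cases p with
  | zero =>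
    -- The zero map stands for d_0; its target plays no role.
    refine ContinuousLinearMap.mem_closure_range_of_dual_exact
      (T := (0 : _ →L[ℂ] (Fin (Module.finrank ℂ (⋀[ℂ]^0 L)) → E))) (fun χ hχ ↦ ⟨0, ?_⟩) rfl
    obtain ⟨χ, rfl⟩ := exists_boundedFunctional_eq χ
    obtain rfl : χ = 0 := h 0 χ ((boundedFunctional_comp_toBounded_eq_zero_iff _ _ _).mp hχ)
    ext1 x
    obtain ⟨c, rfl⟩ := (coordinates E _).surjective x
    rw [boundedFunctional_coordinates, map_zero]
    rfl
  | succ p =>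
    exact ContinuousLinearMap.mem_closure_range_of_dual_exact (hdual p)
      ((boundedD_coordinates_eq_zero ρ f).mpr hc)

end LieComplex

/-! ### Comparison of the two spectra. -/

namespace LieComplex

open exteriorPower

variable {L E : Type*} [LieRing L] [LieAlgebra ℂ L] [NormedAddCommGroup E] [NormedSpace ℂ E]
  (ρ : RightAction L E) (f : Module.Dual ℂ L)

theorem nontrivial_homology_iff (p : ℕ) :
    Nontrivial (Homology ρ f p) ↔ ¬ cycles ρ f p ≤ LinearMap.range (d ρ f p) := by
  rw [Submodule.Quotient.nontrivial_iff, Ne, Submodule.submoduleOf_eq_top]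

variable [FiniteDimensional ℂ L] (ω : ExteriorAlgebra ℂ L →ₗ[ℂ] ℂ)

theorem mem_cycles_dual_iff (hL : ∀ y, LinearMap.trace ℂ L (LieAlgebra.ad ℂ L y) = 0)
    (hω : ∀ w : ⋀[ℂ]^(Module.finrank ℂ (LieOpposite L)) (LieOpposite L),
      ω (ExteriorAlgebra.map (LieOpposite.of L).symm.toLinearMap w) = 0 → w = 0)
    {p q : ℕ} (hpq : p + q = Module.finrank ℂ L)
    (c : StrongDual ℂ E ⊗[ℂ] ⋀[ℂ]^q (LieOpposite L)) :
    c ∈ cycles ρ.dual (f ∘ₗ (LieOpposite.of L).symm.toLinearMap) q ↔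
      functionalOf E _ (poincare E ω p q c) ∘ₗ d ρ f p = 0 := by
  cases q with
  | zero =>
    -- For q = 0 one has p = n: all elements are cycles, and all functionals are cocycles because
    -- ⋀^(n+1) L = 0.
    have : Subsingleton (⋀[ℂ]^(p + 1) L) := subsingleton_of_finrank_lt (by omega)
    refine iff_of_true Submodule.mem_top (LinearMap.ext fun a ↦ ?_)
    rw [Subsingleton.elim a 0, map_zero, map_zero]
  | succ q =>
    have h := functionalOf_poincare_d ω ρ f hL (p := p) (q := q) (by omega) c
    have hinj := (functionalOf_injective (E := E)).comp
      (poincare_bijective E ω hω (p := p + 1) (q := q) (by omega)).1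
    constructor
    · intro hc
      refine LinearMap.ext fun a ↦ (h a).trans ?_
      rw [show d ρ.dual (f ∘ₗ (LieOpposite.of L).symm.toLinearMap) q c = 0 from hc]
      simp
    · intro hc
      refine hinj (LinearMap.ext fun a ↦ ?_)
      have := (h a).symm.trans (LinearMap.congr_fun hc a)
      rw [LinearMap.zero_apply, mul_eq_zero] at this
      simpa using this.resolve_left (pow_ne_zero _ (by simp))

theorem mem_range_dual_iff (hL : ∀ y, LinearMap.trace ℂ L (LieAlgebra.ad ℂ L y) = 0)
    (hω : ∀ w : ⋀[ℂ]^(Module.finrank ℂ (LieOpposite L)) (LieOpposite L),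
      ω (ExteriorAlgebra.map (LieOpposite.of L).symm.toLinearMap w) = 0 → w = 0)
    {p q : ℕ} (hpq : p + q = Module.finrank ℂ L)
    (c : StrongDual ℂ E ⊗[ℂ] ⋀[ℂ]^q (LieOpposite L)) :
    c ∈ LinearMap.range (d ρ.dual (f ∘ₗ (LieOpposite.of L).symm.toLinearMap) q) ↔
      IsCoboundary ρ f p (poincare E ω p q c) := by
  have hbij := poincare_bijective E ω hω hpq
  cases p with
  | zero =>
    have : Subsingleton (⋀[ℂ]^(q + 1) (LieOpposite L)) := subsingleton_of_finrank_lt (by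
      rw [← (LieOpposite.of L).finrank_eq]; omega)
    rw [IsCoboundary, map_eq_zero_iff _ hbij.1]
    constructor
    · rintro ⟨a, rfl⟩
      rw [Subsingleton.elim a 0, map_zero]
    · rintro rfl
      exact zero_mem _
  | succ p =>
    have h := functionalOf_poincare_d ω ρ f hL (p := p) (q := q) (by omega)
    have hsign : (-1 : ℂ) ^ p * (-1) ^ p = 1 := by rw [← mul_pow]; simp
    constructor
    · rintro ⟨a, rfl⟩
      refine ⟨(-1 : ℂ) ^ p • poincare E ω p (q + 1) a, LinearMap.ext fun b ↦ ?_⟩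
      rw [map_smul, LinearMap.comp_apply, LinearMap.smul_apply, h, smul_eq_mul, ← mul_assoc, hsign,
        one_mul]
    · rintro ⟨ψ, hψ⟩
      obtain ⟨a, rfl⟩ := (poincare_bijective E ω hω (p := p) (q := q + 1) (by omega)).2 ψ
      refine ⟨(-1 : ℂ) ^ p • a, hbij.1 (functionalOf_injective (LinearMap.ext fun b ↦ ?_))⟩
      rw [hψ, LinearMap.comp_apply, h, map_smul, map_smul, map_smul]
      rfl

theorem exact_dual_iff [CompleteSpace E] (hf : ∀ x y : L, f ⁅x, y⁆ = 0)
    (hL : ∀ y, LinearMap.trace ℂ L (LieAlgebra.ad ℂ L y) = 0) :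
    (∀ q, cycles ρ.dual (f ∘ₗ (LieOpposite.of L).symm.toLinearMap) q ≤
      LinearMap.range (d ρ.dual (f ∘ₗ (LieOpposite.of L).symm.toLinearMap) q)) ↔
      ∀ p, cycles ρ f p ≤ LinearMap.range (d ρ f p) := by
  obtain ⟨ω, hω⟩ := exists_top_functional (LieOpposite.of L).symm
  constructor
  · refine fun h ↦ exact_of_isCoboundary ρ hf fun p χ hχ ↦ ?_
    rcases le_or_gt p (Module.finrank ℂ L) with hp | hp
    · have hpq : p + (Module.finrank ℂ L - p) = Module.finrank ℂ L := by omega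
      obtain ⟨c, rfl⟩ := (poincare_bijective E ω hω hpq).2 χ
      exact (mem_range_dual_iff ρ f ω hL hω hpq c).mp
        (h _ ((mem_cycles_dual_iff ρ f ω hL hω hpq c).mpr hχ))
    -- Degrees above n have no dual partner, but there the spaces vanish.
    · have : Subsingleton (⋀[ℂ]^p L) := subsingleton_of_finrank_lt hp
      obtain rfl : χ = 0 := LinearMap.ext fun w ↦ by rw [Subsingleton.elim w 0, map_zero, map_zero]
      cases p with
      | zero => rfl
      | succ p => exact ⟨0, by simp⟩
  · intro h q c hc
    rcases le_or_gt q (Module.finrank ℂ L) with hq | hq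
    · have hpq : (Module.finrank ℂ L - q) + q = Module.finrank ℂ L := by omega
      exact (mem_range_dual_iff ρ f ω hL hω hpq c).mpr
        (isCoboundary_of_exact ρ hf h _ _ ((mem_cycles_dual_iff ρ f ω hL hω hpq c).mp hc))
    · have : Subsingleton (⋀[ℂ]^q (LieOpposite L)) := subsingleton_of_finrank_lt (by
        rwa [← (LieOpposite.of L).finrank_eq])
      rw [Subsingleton.elim c 0]
      exact zero_mem _

end LieComplex

theorem mem_jointSpectrum_dual_iff {L E : Type*} [LieRing L] [LieAlgebra ℂ L]
    [FiniteDimensional ℂ L] [LieRing.IsNilpotent L] [NormedAddCommGroup E] [NormedSpace ℂ E]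
    [CompleteSpace E] (ρ : RightAction L E) (f : Module.Dual ℂ L) :
    f ∘ₗ (LieOpposite.of L).symm.toLinearMap ∈ jointSpectrum ρ.dual ↔ f ∈ jointSpectrum ρ := by
  have hbracket : (∀ x y : LieOpposite L,
      (f ∘ₗ (LieOpposite.of L).symm.toLinearMap) ⁅x, y⁆ = 0) ↔ ∀ x y : L, f ⁅x, y⁆ = 0 :=
    ⟨fun h x y ↦ h (LieOpposite.of L y) (LieOpposite.of L x),
      fun h x y ↦ h ((LieOpposite.of L).symm y) ((LieOpposite.of L).symm x)⟩
  simp only [jointSpectrum, Set.mem_ofPred_eq, hbracket, LieComplex.nontrivial_homology_iff,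
    ← not_forall]
  exact and_congr_right fun hf ↦
    not_congr (LieComplex.exact_dual_iff ρ f hf LieAlgebra.trace_ad_eq_zero)

theorem theorem3p4 {L E : Type*} [LieRing L] [LieAlgebra ℂ L] [FiniteDimensional ℂ L]
    [LieRing.IsNilpotent L] [NormedAddCommGroup E] [NormedSpace ℂ E] [CompleteSpace E]
    (ρ : RightAction L E) :
    jointSpectrum ρ =
      (LieOpposite.of L).dualMap '' jointSpectrum ρ.dual := by
  ext f
  rw [← mem_jointSpectrum_dual_iff]
  constructor
  · exact fun hf ↦ ⟨_, hf, LinearMap.ext fun x ↦ rfl⟩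
  · rintro ⟨g, hg, rfl⟩
    exact hg
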